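/- **Setting.** Let $E,A\in\mathbb R^{c\times n}$, $B\in\mathbb R^{c\times m}$. An interval means $\mathbb R$, $[a,\infty)$, $(-\infty,a]$ or $[a,b]$ with $a<b$; on an unbounded interval "absolutely continuous" means absolutely continuous on compact subintervals. A solution of the DAE $\frac{d(Ex)}{dt}=Ax+Bu$ on an interval $I$ is a pair $(x,u)\in L^1_{loc}(I,\mathbb R^n)\times L^1_{loc}(I,\mathbb R^m)$ such that $Ex$ is absolutely continuous and $Ex(t)=Ex(t_0)+\int_{t_0}^t(Ax(s)+Bu(s))\,ds$ for all $t_0\le t$ in $I$; let $\mathcal B_I(E,A,B)$ be the set of these. Let $\mathcal V(E,A,B)$ be the set of all $z\in\mathbb R^c$ such that $z=Ex(0)$ for a solution $(x,u)$ on some interval $I\ni 0$. For $z\in\mathcal V(E,A,B)$ and $t>0$ let $\mathscr D_z(t)$ be the set of solutions on $[0,t]$ with $Ex(0)=z$. Let $A_l\in\mathbb R^{\hat n\times\hat n}$, $B_l\in\mathbb R^{\hat n\times k}$, $C_l\in\mathbb R^{(n+m)\times\hat n}$, $D_l\in\mathbb R^{(n+m)\times k}$, $\hat n\le n$; let $C_s,D_s$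 be the first $n$ rows and $C_u,D_u$ the last $m$ rows of $C_l,D_l$. Assume that $(A_l,B_l,C_l,D_l)$ is an ODE-LTI associated with the DAE, i.e.: 1. either $D_l=0$, $B_l=0$ and $k=1$, or $\operatorname{rank}D_l=k$; 2. $ED_s=0$ and $\operatorname{rank}EC_s=\hat n$; 3. for every interval $I$: for every $(x,u)\in\mathcal B_I(E,A,B)$ there are $v\in AC(I,\mathbb R^{\hat n})$, $g\in L^1_{loc}(I,\mathbb R^k)$ with $\dot v=A_lv+B_lg$ and $(x^T,u^T)^T=C_lv+D_lg$ a.e.; and for all such $v,g$ with $\dot v=A_lv+B_lg$ a.e., $C_lv+D_lg$ is a.e. equal to some element of $\mathcal B_I(E,A,B)$. Let $\mathcal M=(EC_s)^+$ (Moore–Penrose inverse). Let $Q\in\mathbb R^{n\times n}$, $R\in\mathbb R^{m\times m}$ be symmetric positive definite, $Q_0\in\mathbb R^{c\times c}$ symmetric positive semidefinite, $S=\mathrm{diag}(Q,R)$, and $$J_t(x,u)=x(t)^TE^TQ_0Ex(t)+\int_0^t\big(x(s)^TQx(s)+u(s)^TRu(s)\big)ds\in[0,+\infty],\qquad J_t^*=\inf_{(x,u)\in\mathscr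 D_z(t)}J_t(x,u).$$ **Theorem.** The differential Riccati equation $$\dot P=A_l^TP+PA_l-K^T(D_l^TSD_l)K+C_l^TSC_l,\qquad P(0)=(EC_s)^TQ_0EC_s,$$ where $K(s)=(D_l^TSD_l)^{-1}(B_l^TP(s)+D_l^TSC_l)$ if $D_l\ne0$ and $K(s)=0$ if $D_l=0$, has a solution $P$ on $[0,\infty)$, and for each $t>0$ its solution on $[0,t]$ is unique. Let $t>0$ and $z\in\mathcal V(E,A,B)$. The equation $\dot v(s)=(A_l-B_lK(t-s))v(s)$ on $[0,t]$, $v(0)=\mathcal Mz$, has a solution $v$, and with $$\begin{bmatrix}x^*(s)\\u^*(s)\end{bmatrix}=(C_l-D_lK(t-s))\,v(s)$$ the following hold. * $(x^*,u^*)\in\mathscr D_z(t)$ and $J_t(x^*,u^*)=J_t^*<+\infty$; that is, $(x^*,u^*)$ solves the finite-horizon optimal control problem on $[0,t]$ for $z$. * $J_t^*=J_t(x^*,u^*)=(\mathcal Mz)^TP(t)(\mathcal Mz)$. * $u^*(s)=K_f(s)x^*(s)$ for all $s\in[0,t]$, where $K_f(s)=(C_u-D_uK(t-s))\mathcal ME$.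 * With $K_1(s)=(C_l-D_lK(t-s))\mathcal ME-\begin{bmatrix}I_n\\0\end{bmatrix}$ and $K_2=\begin{bmatrix}0\\-I_m\end{bmatrix}$, the pair $(x^*,u^*)$ is the unique solution, up to modification on a set of measure zero, of $$\frac{d(Ex)}{ds}=Ax+Bu,\qquad K_1(s)x(s)+K_2u(s)=0\quad\text{a.e. on }[0,t]$$ with $Ex(0)=z$. More precisely, $(x^*,u^*)$ is such a solution, and for all $(x,u)\in L^1([0,t],\mathbb R^n)\times L^1([0,t],\mathbb R^m)$ with $Ex$ absolutely continuous and $Ex(0)=z$, $(x,u)$ solves this system if and only if $(x,u)=(x^*,u^*)$ a.e. -/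

import Mathlib

open Matrix MeasureTheory

namespace DaeLQ

/-! ### Moore–Penrose inverse -/

/-- The four Penrose equations: `X` is the Moore–Penrose inverse of the real matrix `N`. -/
structure IsMoorePenrose {p q : ℕ} (N : Matrix (Fin p) (Fin q) ℝ)
    (X : Matrix (Fin q) (Fin p) ℝ) : Prop where
  left : N * X * N = N
  right : X * N * X = X
  symm_left : (N * X)ᵀ = N * X
  symm_right : (X * N)ᵀ = X * N

lemma exists_normal_eq {p q : ℕ} (N : Matrix (Fin p) (Fin q) ℝ) :
    ∃ Y : Matrix (Fin q) (Fin p) ℝ, N * Y * N = N ∧ (N * Y)ᵀ = N * Y := by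
  have hle : LinearMap.range (Nᵀ * N).mulVecLin ≤ LinearMap.range Nᵀ.mulVecLin := by
    rintro _ ⟨w, rfl⟩
    exact ⟨N *ᵥ w, by simp⟩
  have hrank : Module.finrank ℝ (LinearMap.range (Nᵀ * N).mulVecLin) =
      Module.finrank ℝ (LinearMap.range Nᵀ.mulVecLin) := by
    have h1 : (Nᵀ * N).rank = Nᵀ.rank := by
      rw [Matrix.rank_transpose_mul_self, Matrix.rank_transpose]
    exact h1
  have heq := Submodule.eq_of_le_of_finrank_eq hle hrank
  have hcol : ∀ j : Fin p, ∃ y : Fin q → ℝ, (Nᵀ * N) *ᵥ y = fun i => Nᵀ i j := by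
    intro j
    have hmem : (fun i => Nᵀ i j) ∈ LinearMap.range Nᵀ.mulVecLin :=
      ⟨Pi.single j 1, by ext i; simp⟩
    rw [← heq] at hmem
    obtain ⟨y, hy⟩ := hmem
    exact ⟨y, hy⟩
  choose y hy using hcol
  let Y : Matrix (Fin q) (Fin p) ℝ := Matrix.of fun i j => y j i
  have hY : Nᵀ * N * Y = Nᵀ := by
    ext i j
    have := congrFun (hy j) i
    simpa [Matrix.mul_apply, Matrix.mulVec, dotProduct, Y] using this
  have hsym : (N * Y)ᵀ = N * Y := by
    have h1 : (N * Y)ᵀ * (N * Y) = (N * Y)ᵀ := by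
      rw [Matrix.transpose_mul, Matrix.mul_assoc, ← Matrix.mul_assoc Nᵀ, hY]
    have h2 := congrArg Matrix.transpose h1
    rw [Matrix.transpose_mul, Matrix.transpose_transpose, h1] at h2
    exact h2
  refine ⟨Y, ?_, hsym⟩
  have h3 : (N * Y)ᵀ * N = N := by
    have h4 := congrArg Matrix.transpose hY
    rw [Matrix.mul_assoc, Matrix.transpose_mul, Matrix.transpose_transpose] at h4
    exact h4
  rwa [hsym] at h3

lemma exists_isMoorePenrose {p q : ℕ} (N : Matrix (Fin p) (Fin q) ℝ) :
    ∃ X : Matrix (Fin q) (Fin p) ℝ, IsMoorePenrose N X := by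
  obtain ⟨Y, hY, hYs⟩ := exists_normal_eq N
  obtain ⟨Z', hZ, hZs⟩ := exists_normal_eq Nᵀ
  have hZ2 : N * Z'ᵀ * N = N := by
    have := congrArg Matrix.transpose hZ
    simpa [Matrix.transpose_mul, Matrix.mul_assoc] using this
  have hZs2 : (Z'ᵀ * N)ᵀ = Z'ᵀ * N := by
    have := congrArg Matrix.transpose hZs
    simpa [Matrix.transpose_mul] using this
  have hNX : N * (Z'ᵀ * N * Y) = N * Y := by
    rw [← Matrix.mul_assoc, ← Matrix.mul_assoc, hZ2]
  have hXN : Z'ᵀ * N * Y * N = Z'ᵀ * N := by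
    rw [Matrix.mul_assoc, Matrix.mul_assoc, ← Matrix.mul_assoc N, hY]
  refine ⟨Z'ᵀ * N * Y, ?_, ?_, ?_, ?_⟩
  · rw [hNX, hY]
  · rw [hXN, ← Matrix.mul_assoc, ← Matrix.mul_assoc, Matrix.mul_assoc Z'ᵀ,
      Matrix.mul_assoc Z'ᵀ, hZ2]
  · rw [hNX, hYs]
  · rw [hXN, hZs2]

lemma IsMoorePenrose.unique {p q : ℕ} {N : Matrix (Fin p) (Fin q) ℝ}
    {X Y : Matrix (Fin q) (Fin p) ℝ} (hX : IsMoorePenrose N X) (hY : IsMoorePenrose N Y) :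
    X = Y := by
  have h1 : N * X = N * Y := by
    have h : (N * Y * (N * X))ᵀ = N * X * (N * Y) := by
      rw [Matrix.transpose_mul, hX.symm_left, hY.symm_left]
    rw [← Matrix.mul_assoc, ← Matrix.mul_assoc, hX.left, hY.left, hX.symm_left] at h
    exact h
  have h2 : X * N = Y * N := by
    have h : (X * N * (Y * N))ᵀ = Y * N * (X * N) := by
      rw [Matrix.transpose_mul, hX.symm_right, hY.symm_right]
    rw [Matrix.mul_assoc, ← Matrix.mul_assoc N, hY.left, Matrix.mul_assoc Y,
      ← Matrix.mul_assoc N, hX.left, hX.symm_right] at h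
    exact h
  rw [← hX.right, h2, Matrix.mul_assoc, h1, ← Matrix.mul_assoc, hY.right]

/-- The Moore–Penrose inverse `N⁺` of a real matrix. -/
noncomputable def pinv {p q : ℕ} (N : Matrix (Fin p) (Fin q) ℝ) : Matrix (Fin q) (Fin p) ℝ :=
  Classical.choose (exists_isMoorePenrose N)

lemma pinv_spec {p q : ℕ} (N : Matrix (Fin p) (Fin q) ℝ) : IsMoorePenrose N (pinv N) :=
  Classical.choose_spec (exists_isMoorePenrose N)

/-! ### Function classes on intervals

A function on an interval `I` is represented by a function on `ℝ` of which only the values on `I`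
are used. -/

/-- The (nondegenerate) time intervals `ℝ`, `[a,∞)`, `(-∞,a]`, `[a,b]` with `a < b`. -/
def IsTimeInterval (I : Set ℝ) : Prop :=
  I = Set.univ ∨ (∃ a, I = Set.Ici a) ∨ (∃ a, I = Set.Iic a) ∨ ∃ a b, a < b ∧ I = Set.Icc a b

/-- `f ∈ AC(I, ℝ^ι)`: `f` is absolutely continuous on every compact subinterval of `I`
(for compact `I` this is absolute continuity on `I`). -/
def IsAC {ι : Type} [Fintype ι] (I : Set ℝ) (f : ℝ → ι → ℝ) : Prop :=
  ∀ a b, a ≤ b → Set.Icc a b ⊆ I → AbsolutelyContinuousOnInterval f a b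

/-- `f ∈ L¹_loc(I, ℝ^ι)`. -/
def IsL1loc {ι : Type} [Fintype ι] (I : Set ℝ) (f : ℝ → ι → ℝ) : Prop :=
  LocallyIntegrableOn f I volume

/-! ### Solutions of the DAE `d(Ex)/dt = Ax + Bu` -/

/-- `(x,u) ∈ 𝓑_I(E,A,B)`: `(x,u)` is a solution of `d(Ex)/dt = Ax + Bu` on `I`. -/
structure IsSolution {c n m : ℕ} (E A : Matrix (Fin c) (Fin n) ℝ) (B : Matrix (Fin c) (Fin m) ℝ)
    (I : Set ℝ) (x : ℝ → Fin n → ℝ) (u : ℝ → Fin m → ℝ) : Prop where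
  x_loc : IsL1loc I x
  u_loc : IsL1loc I u
  Ex_ac : IsAC I (fun s => E *ᵥ x s)
  eq : ∀ t₀ ∈ I, ∀ t ∈ I, t₀ ≤ t →
    E *ᵥ x t = E *ᵥ x t₀ + ∫ s in t₀..t, (A *ᵥ x s + B *ᵥ u s)

/-- `𝓑_I(E,A,B)` as a set of functions with values in `ℝ^{n+m}`. -/
def behavior {c n m : ℕ} (E A : Matrix (Fin c) (Fin n) ℝ) (B : Matrix (Fin c) (Fin m) ℝ)
    (I : Set ℝ) : Set (ℝ → Fin n ⊕ Fin m → ℝ) :=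
  {w | IsSolution E A B I (fun s i => w s (Sum.inl i)) (fun s j => w s (Sum.inr j))}

/-- The set `𝓥(E,A,B)` of differentiably consistent vectors. -/
def consistencySet {c n m : ℕ} (E A : Matrix (Fin c) (Fin n) ℝ) (B : Matrix (Fin c) (Fin m) ℝ) :
    Set (Fin c → ℝ) :=
  {z | ∃ I, IsTimeInterval I ∧ (0 : ℝ) ∈ I ∧ ∃ x u, IsSolution E A B I x u ∧ E *ᵥ x 0 = z}

/-! ### ODE-LTIs and association -/

/-- `(p,q) ∈ AC × L¹_loc` and `ṗ = F p + G q` a.e. on `I`. -/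
structure IsODETrajectory {r k : ℕ} (F : Matrix (Fin r) (Fin r) ℝ) (G : Matrix (Fin r) (Fin k) ℝ)
    (I : Set ℝ) (p : ℝ → Fin r → ℝ) (q : ℝ → Fin k → ℝ) : Prop where
  p_ac : IsAC I p
  q_loc : IsL1loc I q
  deriv_eq : ∀ᵐ s ∂(volume.restrict I), HasDerivAt p (F *ᵥ p s + G *ᵥ q s) s

/-- The ODE-LTI `ṗ = F p + G q`, `z = C p + D q` is a realization of `𝓑` on `I`. -/
structure IsRealization {ι : Type} [Fintype ι] {r k : ℕ} (F : Matrix (Fin r) (Fin r) ℝ)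
    (G : Matrix (Fin r) (Fin k) ℝ) (C : Matrix ι (Fin r) ℝ) (D : Matrix ι (Fin k) ℝ)
    (I : Set ℝ) (𝓑 : Set (ℝ → ι → ℝ)) : Prop where
  of_mem : ∀ z ∈ 𝓑, ∃ p q, IsODETrajectory F G I p q ∧
    ∀ᵐ s ∂(volume.restrict I), z s = C *ᵥ p s + D *ᵥ q s
  exists_mem : ∀ p q, IsODETrajectory F G I p q → ∃ z ∈ 𝓑,
    ∀ᵐ s ∂(volume.restrict I), z s = C *ᵥ p s + D *ᵥ q s

/-- `(A_l,B_l,C_l,D_l)` is an ODE-LTI associated with the DAE-LTI `d(Ex)/dt = Ax + Bu`. The rows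
of `C_l`, `D_l` are indexed by `Fin n ⊕ Fin m`, so that `toRows₁` selects the first `n` rows
(giving `C_s`, `D_s`) and `toRows₂` the last `m` rows (giving `C_u`, `D_u`). -/
structure IsAssociated {c n m nh k : ℕ} (E A : Matrix (Fin c) (Fin n) ℝ)
    (B : Matrix (Fin c) (Fin m) ℝ) (Al : Matrix (Fin nh) (Fin nh) ℝ)
    (Bl : Matrix (Fin nh) (Fin k) ℝ) (Cl : Matrix (Fin n ⊕ Fin m) (Fin nh) ℝ)
    (Dl : Matrix (Fin n ⊕ Fin m) (Fin k) ℝ) : Prop where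
  dim_le : nh ≤ n
  input : (Dl = 0 ∧ Bl = 0 ∧ k = 1) ∨ Dl.rank = k
  E_Ds : E * Dl.toRows₁ = 0
  rank_E_Cs : (E * Cl.toRows₁).rank = nh
  realization : ∀ I, IsTimeInterval I → IsRealization Al Bl Cl Dl I (behavior E A B I)

/-- The state map `𝓜 = (E C_s)⁺`. -/
noncomputable def stateMap {c n m nh : ℕ} (E : Matrix (Fin c) (Fin n) ℝ)
    (Cl : Matrix (Fin n ⊕ Fin m) (Fin nh) ℝ) : Matrix (Fin nh) (Fin c) ℝ :=
  pinv (E * Cl.toRows₁)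

/-! ### The finite-horizon problem -/

/-- `(x,u) ∈ 𝓓_z(t)`. -/
def IsAdmissible {c n m : ℕ} (E A : Matrix (Fin c) (Fin n) ℝ) (B : Matrix (Fin c) (Fin m) ℝ)
    (z : Fin c → ℝ) (t : ℝ) (x : ℝ → Fin n → ℝ) (u : ℝ → Fin m → ℝ) : Prop :=
  IsSolution E A B (Set.Icc 0 t) x u ∧ E *ᵥ x 0 = z

/-- The cost `J_t(x,u) = x(t)ᵀEᵀQ₀Ex(t) + ∫₀ᵗ (xᵀQx + uᵀRu) ds ∈ (-∞,+∞]`. The integrand is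
nonnegative when `Q, R > 0`; the integral is `+∞` if it diverges. -/
noncomputable def cost {c n m : ℕ} (E : Matrix (Fin c) (Fin n) ℝ) (Q : Matrix (Fin n) (Fin n) ℝ)
    (R : Matrix (Fin m) (Fin m) ℝ) (Q₀ : Matrix (Fin c) (Fin c) ℝ) (t : ℝ)
    (x : ℝ → Fin n → ℝ) (u : ℝ → Fin m → ℝ) : EReal :=
  (((E *ᵥ x t) ⬝ᵥ (Q₀ *ᵥ (E *ᵥ x t)) : ℝ) : EReal) +
    ((∫⁻ s in Set.Icc 0 t, ENNReal.ofReal (x s ⬝ᵥ (Q *ᵥ x s) + u s ⬝ᵥ (R *ᵥ u s)) : ENNReal) :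
      EReal)

/-- `J_t^* = inf {J_t(x,u) : (x,u) ∈ 𝓓_z(t)}`. -/
noncomputable def optimalCost {c n m : ℕ} (E A : Matrix (Fin c) (Fin n) ℝ)
    (B : Matrix (Fin c) (Fin m) ℝ) (Q : Matrix (Fin n) (Fin n) ℝ) (R : Matrix (Fin m) (Fin m) ℝ)
    (Q₀ : Matrix (Fin c) (Fin c) ℝ) (z : Fin c → ℝ) (t : ℝ) : EReal :=
  sInf {J | ∃ x u, IsAdmissible E A B z t x u ∧ J = cost E Q R Q₀ t x u}

/-- `(x,u)` is a solution of the finite-horizon optimal control problem on `[0,t]` for the initial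
state `z`. -/
structure IsOptimal {c n m : ℕ} (E A : Matrix (Fin c) (Fin n) ℝ) (B : Matrix (Fin c) (Fin m) ℝ)
    (Q : Matrix (Fin n) (Fin n) ℝ) (R : Matrix (Fin m) (Fin m) ℝ) (Q₀ : Matrix (Fin c) (Fin c) ℝ)
    (z : Fin c → ℝ) (t : ℝ) (x : ℝ → Fin n → ℝ) (u : ℝ → Fin m → ℝ) : Prop where
  admissible : IsAdmissible E A B z t x u
  cost_eq : cost E Q R Q₀ t x u = optimalCost E A B Q R Q₀ z t
  cost_lt_top : optimalCost E A B Q R Q₀ z t < ⊤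

/-! ### The differential Riccati equation and the feedback -/

/-- `S = diag(Q,R)`. -/
def weight {n m : ℕ} (Q : Matrix (Fin n) (Fin n) ℝ) (R : Matrix (Fin m) (Fin m) ℝ) :
    Matrix (Fin n ⊕ Fin m) (Fin n ⊕ Fin m) ℝ :=
  Matrix.fromBlocks Q 0 0 R

open Classical in
/-- `K = (D_lᵀ S D_l)⁻¹ (B_lᵀ P + D_lᵀ S C_l)` if `D_l ≠ 0`, and `K = 0` if `D_l = 0`. -/
noncomputable def gain {n m nh k : ℕ} (S : Matrix (Fin n ⊕ Fin m) (Fin n ⊕ Fin m) ℝ)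
    (Bl : Matrix (Fin nh) (Fin k) ℝ) (Cl : Matrix (Fin n ⊕ Fin m) (Fin nh) ℝ)
    (Dl : Matrix (Fin n ⊕ Fin m) (Fin k) ℝ) (P : Matrix (Fin nh) (Fin nh) ℝ) :
    Matrix (Fin k) (Fin nh) ℝ :=
  if Dl ≠ 0 then (Dlᵀ * S * Dl)⁻¹ * (Blᵀ * P + Dlᵀ * S * Cl) else 0

/-- `P` solves, on the set `J` of times, the differential Riccati equation
`Ṗ = A_lᵀP + PA_l - Kᵀ(D_lᵀSD_l)K + C_lᵀSC_l`, `P(0) = (EC_s)ᵀQ₀EC_s`. -/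
structure IsRiccatiSolution {c n m nh k : ℕ} (E : Matrix (Fin c) (Fin n) ℝ)
    (Q : Matrix (Fin n) (Fin n) ℝ) (R : Matrix (Fin m) (Fin m) ℝ) (Q₀ : Matrix (Fin c) (Fin c) ℝ)
    (Al : Matrix (Fin nh) (Fin nh) ℝ) (Bl : Matrix (Fin nh) (Fin k) ℝ)
    (Cl : Matrix (Fin n ⊕ Fin m) (Fin nh) ℝ) (Dl : Matrix (Fin n ⊕ Fin m) (Fin k) ℝ)
    (J : Set ℝ) (P : ℝ → Matrix (Fin nh) (Fin nh) ℝ) : Prop where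
  init : P 0 = (E * Cl.toRows₁)ᵀ * Q₀ * (E * Cl.toRows₁)
  deriv_eq : ∀ s ∈ J, HasDerivWithinAt P
    (Alᵀ * P s + P s * Al
      - (gain (weight Q R) Bl Cl Dl (P s))ᵀ * (Dlᵀ * weight Q R * Dl) *
          gain (weight Q R) Bl Cl Dl (P s)
      + Clᵀ * weight Q R * Cl) J s

/-- `v` solves on `[0,t]` the closed-loop equation `v̇(s) = (A_l - B_l K(t-s)) v(s)`, `v(0) = v₀`. -/
structure IsClosedLoop {nh k : ℕ} (Al : Matrix (Fin nh) (Fin nh) ℝ)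
    (Bl : Matrix (Fin nh) (Fin k) ℝ) (K : ℝ → Matrix (Fin k) (Fin nh) ℝ) (t : ℝ)
    (v₀ : Fin nh → ℝ) (v : ℝ → Fin nh → ℝ) : Prop where
  init : v 0 = v₀
  deriv_eq : ∀ s ∈ Set.Icc 0 t, HasDerivWithinAt v ((Al - Bl * K (t - s)) *ᵥ v s) (Set.Icc 0 t) s

/-- `K_f(s) = (C_u - D_u K(t-s)) 𝓜 E`. -/
noncomputable def inputFeedback {c n m nh k : ℕ} (E : Matrix (Fin c) (Fin n) ℝ)
    (Cl : Matrix (Fin n ⊕ Fin m) (Fin nh) ℝ) (Dl : Matrix (Fin n ⊕ Fin m) (Fin k) ℝ)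
    (K : ℝ → Matrix (Fin k) (Fin nh) ℝ) (t s : ℝ) : Matrix (Fin m) (Fin n) ℝ :=
  (Cl.toRows₂ - Dl.toRows₂ * K (t - s)) * stateMap E Cl * E

/-- `K₁(s) = (C_l - D_l K(t-s)) 𝓜 E - [Iₙ; 0]`. -/
noncomputable def K₁ {c n m nh k : ℕ} (E : Matrix (Fin c) (Fin n) ℝ)
    (Cl : Matrix (Fin n ⊕ Fin m) (Fin nh) ℝ) (Dl : Matrix (Fin n ⊕ Fin m) (Fin k) ℝ)
    (K : ℝ → Matrix (Fin k) (Fin nh) ℝ) (t s : ℝ) : Matrix (Fin n ⊕ Fin m) (Fin n) ℝ :=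
  (Cl - Dl * K (t - s)) * stateMap E Cl * E - Matrix.fromRows 1 0

/-- `K₂ = [0; -I_m]`. -/
def K₂ (n m : ℕ) : Matrix (Fin n ⊕ Fin m) (Fin m) ℝ :=
  Matrix.fromRows 0 (-1)

/-- `(x,u)` is a solution on `[0,t]` of `d(Ex)/ds = Ax + Bu`, `K₁(s) x(s) + K₂ u(s) = 0`. -/
def IsAugmentedSolution {c n m nh k : ℕ} (E A : Matrix (Fin c) (Fin n) ℝ)
    (B : Matrix (Fin c) (Fin m) ℝ)
    (Cl : Matrix (Fin n ⊕ Fin m) (Fin nh) ℝ) (Dl : Matrix (Fin n ⊕ Fin m) (Fin k) ℝ)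
    (K : ℝ → Matrix (Fin k) (Fin nh) ℝ) (t : ℝ)
    (x : ℝ → Fin n → ℝ) (u : ℝ → Fin m → ℝ) : Prop :=
  IsSolution E A B (Set.Icc 0 t) x u ∧
    ∀ᵐ s ∂(volume.restrict (Set.Icc 0 t)), K₁ E Cl Dl K t s *ᵥ x s + K₂ n m *ᵥ u s = 0

end DaeLQ

namespace DaeLQ

/-! ### Calculus of matrix-valued functions -/

section Calculus

variable {ι κ l : Type} [Fintype κ] {J : Set ℝ} {s : ℝ}

/-! The associated ODE-LTI turns the DAE problem into a linear-quadratic problem for `v' = A_l v +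
B_l g` with output `w = (x, u) = C_l v + D_l g`. Since `E D_s = 0` and `E C_s` has full column rank,
`Ex = E C_s v`. Hence `v = 𝓜 E x` at every time, so the state is recoverable from `x`, the initial
state is forced to be `𝓜 z`, and the terminal cost is a quadratic form in `v(t)`.

Write `M = D_lᵀ S D_l` and let `K` be the gain at `P`. Completing the square (`complete_square`)
shows that along every trajectory `V(s) = v(s)ᵀ P(t-s) v(s)` satisfies `V' = (g + K v)ᵀ M (g + K v)
- wᵀ S w`, with `K` taken at time `t-s`. Integration gives `J_t ≥ V(0) = (𝓜z)ᵀ P(t) (𝓜z)`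
(`IsAdmissible.le_cost`), with equality for the feedback `g = -K v` (`IsClosedLoop.cost_eq`).

Global existence of `P` comes from the Hamiltonian system. With `Ah = A_l - B_l M⁻¹ D_lᵀ S C_l`, `G
= B_l M⁻¹ B_lᵀ` and `Qh` the Schur complement of `M` in the running cost, one solves the linear
system for `(X, Y)` starting at `(1, P(0))` and sets `P = Y X⁻¹`. Definiteness keeps `X` invertible
(`isUnit_of_hamiltonian`), and the same `X`, run backwards in time, is a fundamental matrix of the
closed loop. Uniqueness and symmetry of `P` follow because the relevant difference solves a
homogeneous Sylvester equation.

For the augmented system, the algebraic constraint forces `D_l (g + K v) = 0`, hence `B_l (g + K v)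
= 0`. The state therefore satisfies the closed-loop equation, whose solution is unique
(`IsClosedLoop.ae_eq`). -/

lemma hasDerivWithinAt_matrix_iff {M : ℝ → Matrix ι κ ℝ} {M' : Matrix ι κ ℝ} :
    HasDerivWithinAt M M' J s ↔ ∀ i j, HasDerivWithinAt (fun r => M r i j) (M' i j) J s := by
  refine (hasDerivWithinAt_pi (φ := fun r => (M r : ι → κ → ℝ))).trans ?_
  exact forall_congr' fun i => hasDerivWithinAt_pi

lemma hasDerivWithinAt_mul [Fintype l] {M : ℝ → Matrix ι κ ℝ} {M' : Matrix ι κ ℝ} {N : ℝ → Matrix κ l ℝ}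
    {N' : Matrix κ l ℝ} (hM : HasDerivWithinAt M M' J s) (hN : HasDerivWithinAt N N' J s) :
    HasDerivWithinAt (fun r => M r * N r) (M' * N s + M s * N') J s := by
  rw [hasDerivWithinAt_matrix_iff] at *
  intro i j
  simp only [Matrix.mul_apply, Matrix.add_apply, ← Finset.sum_add_distrib]
  exact HasDerivWithinAt.fun_sum fun k _ => (hM i k).mul (hN k j)

lemma hasDerivWithinAt_mulVec {M : ℝ → Matrix ι κ ℝ} {M' : Matrix ι κ ℝ} {v : ℝ → κ → ℝ}
    {v' : κ → ℝ} (hM : HasDerivWithinAt M M' J s) (hv : HasDerivWithinAt v v' J s) :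
    HasDerivWithinAt (fun r => M r *ᵥ v r) (M' *ᵥ v s + M s *ᵥ v') J s := by
  rw [hasDerivWithinAt_matrix_iff] at hM
  rw [hasDerivWithinAt_pi] at *
  intro i
  simp only [Matrix.mulVec, dotProduct, Pi.add_apply, ← Finset.sum_add_distrib]
  exact HasDerivWithinAt.fun_sum fun k _ => (hM i k).mul (hv k)

lemma hasDerivWithinAt_dotProduct {v w : ℝ → κ → ℝ} {v' w' : κ → ℝ}
    (hv : HasDerivWithinAt v v' J s) (hw : HasDerivWithinAt w w' J s) :
    HasDerivWithinAt (fun r => v r ⬝ᵥ w r) (v' ⬝ᵥ w s + v s ⬝ᵥ w') J s := by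
  rw [hasDerivWithinAt_pi] at *
  simp only [dotProduct, ← Finset.sum_add_distrib]
  exact HasDerivWithinAt.fun_sum fun k _ => (hv k).mul (hw k)

lemma hasDerivWithinAt_transpose [Fintype ι] {M : ℝ → Matrix ι κ ℝ} {M' : Matrix ι κ ℝ}
    (hM : HasDerivWithinAt M M' J s) : HasDerivWithinAt (fun r => (M r)ᵀ) M'ᵀ J s := by
  rw [hasDerivWithinAt_matrix_iff] at *
  exact fun i j => hM j i

lemma hasDerivWithinAt_matrix_mono {M : ℝ → Matrix ι κ ℝ} {M' : Matrix ι κ ℝ} {J' : Set ℝ}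
    (hM : HasDerivWithinAt M M' J s) (hJ : J' ⊆ J) : HasDerivWithinAt M M' J' s :=
  hasDerivWithinAt_matrix_iff.2 fun i j => (hasDerivWithinAt_matrix_iff.1 hM i j).mono hJ

lemma hasDerivWithinAt_matrix_sub {M N : ℝ → Matrix ι κ ℝ} {M' N' : Matrix ι κ ℝ}
    (hM : HasDerivWithinAt M M' J s) (hN : HasDerivWithinAt N N' J s) :
    HasDerivWithinAt (fun r => M r - N r) (M' - N') J s :=
  hasDerivWithinAt_matrix_iff.2 fun i j =>
    (hasDerivWithinAt_matrix_iff.1 hM i j).sub (hasDerivWithinAt_matrix_iff.1 hN i j)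

lemma continuousOn_of_hasDerivWithinAt_matrix {M M' : ℝ → Matrix ι κ ℝ}
    (hM : ∀ r ∈ J, HasDerivWithinAt M (M' r) J r) : ContinuousOn M J := by
  refine continuousOn_pi.2 fun i => continuousOn_pi.2 fun j r hr => ?_
  exact (hasDerivWithinAt_matrix_iff.1 (hM r hr) i j).continuousWithinAt

end Calculus

/-! ### Linear matrix differential equations: uniqueness by a Grönwall estimate, existence by the
exponential -/

section LinearODE

variable {r : ℕ} {t : ℝ}

open scoped Matrix.Norms.Operator in
/-- Uniqueness for the Sylvester equation `Ẇ = UW + WZ`. -/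
lemma eq_zero_of_sylvester {U Z W : ℝ → Matrix (Fin r) (Fin r) ℝ}
    (hU : ContinuousOn U (Set.Icc 0 t)) (hZ : ContinuousOn Z (Set.Icc 0 t))
    (hW : ∀ s ∈ Set.Icc 0 t, HasDerivWithinAt W (U s * W s + W s * Z s) (Set.Icc 0 t) s)
    (h0 : W 0 = 0) : ∀ s ∈ Set.Icc 0 t, W s = 0 := by
  obtain ⟨a, ha⟩ := isCompact_Icc.exists_bound_of_continuousOn hU
  obtain ⟨b, hb⟩ := isCompact_Icc.exists_bound_of_continuousOn hZ
  refine eq_zero_of_abs_deriv_le_mul_abs_self_of_eq_zero_right (K := a + b)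
    (fun s hs => (hW s hs).continuousWithinAt)
    (fun s hs => (hW s ⟨hs.1, hs.2.le⟩).mono_of_mem_nhdsWithin ?_) h0 ?_
  · exact Filter.mem_of_superset (Icc_mem_nhdsGE hs.2) (Set.Icc_subset_Icc_left hs.1)
  · intro s hs
    have hs' : s ∈ Set.Icc 0 t := ⟨hs.1, hs.2.le⟩
    calc ‖U s * W s + W s * Z s‖ ≤ ‖U s‖ * ‖W s‖ + ‖W s‖ * ‖Z s‖ :=
          (norm_add_le _ _).trans (add_le_add (norm_mul_le _ _) (norm_mul_le _ _))
      _ ≤ a * ‖W s‖ + ‖W s‖ * b := by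
          gcongr
          exacts [ha s hs', hb s hs']
      _ = (a + b) * ‖W s‖ := by ring

open scoped Matrix.Norms.Operator in
/-- Uniqueness for the linear equation `v̇ = F(s)v` on `[0,t]`. -/
lemma eq_zero_of_linear_ode {F : ℝ → Matrix (Fin r) (Fin r) ℝ} {v : ℝ → Fin r → ℝ}
    (hF : ContinuousOn F (Set.Icc 0 t))
    (hv : ∀ s ∈ Set.Icc 0 t, HasDerivWithinAt v (F s *ᵥ v s) (Set.Icc 0 t) s)
    (h0 : v 0 = 0) : ∀ s ∈ Set.Icc 0 t, v s = 0 := by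
  obtain ⟨a, ha⟩ := isCompact_Icc.exists_bound_of_continuousOn hF
  refine eq_zero_of_abs_deriv_le_mul_abs_self_of_eq_zero_right (K := a)
    (fun s hs => (hv s hs).continuousWithinAt)
    (fun s hs => (hv s ⟨hs.1, hs.2.le⟩).mono_of_mem_nhdsWithin ?_) h0 ?_
  · exact Filter.mem_of_superset (Icc_mem_nhdsGE hs.2) (Set.Icc_subset_Icc_left hs.1)
  · intro s hs
    exact (Matrix.linfty_opNorm_mulVec _ _).trans
      (mul_le_mul_of_nonneg_right (ha s ⟨hs.1, hs.2.le⟩) (norm_nonneg _))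

open scoped Matrix.Norms.Operator in
/-- The linear equation `Ż = HZ`, `Z(0) = Z₀` is solvable on `ℝ`. -/
lemma exists_hasDerivWithinAt_eq_mul {ι κ : Type} [Fintype ι] [DecidableEq ι] [Fintype κ]
    (H : Matrix ι ι ℝ) (Z₀ : Matrix ι κ ℝ) :
    ∃ Z : ℝ → Matrix ι κ ℝ, Z 0 = Z₀ ∧ ∀ s J, HasDerivWithinAt Z (H * Z s) J s := by
  refine ⟨fun s => NormedSpace.exp (s • H) * Z₀, by simp, fun s J => ?_⟩
  have h : HasDerivWithinAt (fun u : ℝ => NormedSpace.exp (u • H))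
      (H * NormedSpace.exp (s • H)) J s := (hasDerivAt_exp_smul_const' H s).hasDerivWithinAt
  simpa [Matrix.mul_assoc] using hasDerivWithinAt_mul h (hasDerivWithinAt_const s J Z₀)

end LinearODE

/-! ### Riccati equation through the Hamiltonian system -/

section Riccati

variable {r : ℕ}

open scoped Matrix.Norms.Operator in
lemma hasDerivWithinAt_matrix_inv {X : ℝ → Matrix (Fin r) (Fin r) ℝ}
    {X' : Matrix (Fin r) (Fin r) ℝ} {J : Set ℝ} {s : ℝ}
    (hX : HasDerivWithinAt X X' J s) (hu : IsUnit (X s)) :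
    HasDerivWithinAt (fun a => (X a)⁻¹) (-((X s)⁻¹ * X' * (X s)⁻¹)) J s := by
  obtain ⟨u, hu⟩ := hu
  have h := (hasFDerivAt_ringInverse (𝕜 := ℝ) u)
  rw [hu] at h
  have h2 := h.comp_hasDerivWithinAt s hX
  have h3 : (↑u⁻¹ : Matrix (Fin r) (Fin r) ℝ) = (X s)⁻¹ := by
    rw [← hu, Matrix.coe_units_inv]
  rw [h3] at h2
  simpa [Function.comp_def, Matrix.nonsing_inv_eq_ringInverse] using! h2

lemma hasDerivWithinAt_comp_const_sub {F : Type} [NormedAddCommGroup F] [NormedSpace ℝ F]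
    {v : ℝ → F} {v' : F} {t s : ℝ} (hv : HasDerivWithinAt v v' (Set.Icc 0 t) (t - s)) :
    HasDerivWithinAt (fun a => v (t - a)) (-v') (Set.Icc 0 t) s := by
  have h : HasDerivWithinAt (fun a : ℝ => t - a) (-1) (Set.Icc 0 t) s := by
    simpa using (hasDerivWithinAt_id s (Set.Icc 0 t)).const_sub t
  simpa using! hv.scomp s h fun a ha => ⟨by linarith [ha.2], by linarith [ha.1]⟩

/-- The first block of the solution of the Hamiltonian system with initial value `(1, P₀)` stays
invertible for positive times. -/
lemma isUnit_of_hamiltonian {Ah G Qh P₀ : Matrix (Fin r) (Fin r) ℝ} (hG : G.PosSemidef)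
    (hQ : Qh.PosSemidef) (hP : P₀.PosSemidef) {X Y : ℝ → Matrix (Fin r) (Fin r) ℝ}
    (hX0 : X 0 = 1) (hY0 : Y 0 = P₀)
    (hX : ∀ s J, HasDerivWithinAt X (-Ah * X s + G * Y s) J s)
    (hY : ∀ s J, HasDerivWithinAt Y (Qh * X s + Ahᵀ * Y s) J s) {t : ℝ} (ht : 0 ≤ t) :
    IsUnit (X t) := by
  rcases ht.eq_or_lt with rfl | ht
  · rw [hX0]; exact isUnit_one
  rw [← Matrix.mulVec_injective_iff_isUnit]
  -- For a kernel vector `ξ` of `X t`, the pairing of `Xξ` with `Yξ` is nondecreasing, nonnegative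
  -- at `0` and zero at `t`, hence zero in between.
  refine (injective_iff_map_eq_zero (X t).mulVecLin).2 fun ξ hξ => ?_
  set x : ℝ → Fin r → ℝ := fun s => X s *ᵥ ξ with hx
  set y : ℝ → Fin r → ℝ := fun s => Y s *ᵥ ξ with hy
  have hx' : ∀ s J, HasDerivWithinAt x (-(Ah *ᵥ x s) + G *ᵥ y s) J s := fun s J => by
    have := hasDerivWithinAt_mulVec (hX s J) (hasDerivWithinAt_const s J ξ)
    simpa [hx, hy, Matrix.add_mulVec, Matrix.mulVec_mulVec, Matrix.neg_mulVec] using this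
  have hy' : ∀ s J, HasDerivWithinAt y (Qh *ᵥ x s + Ahᵀ *ᵥ y s) J s := fun s J => by
    have := hasDerivWithinAt_mulVec (hY s J) (hasDerivWithinAt_const s J ξ)
    simpa [hx, hy, Matrix.add_mulVec, Matrix.mulVec_mulVec] using this
  have hφ : ∀ s J, HasDerivWithinAt (fun s => x s ⬝ᵥ y s)
      (y s ⬝ᵥ (G *ᵥ y s) + x s ⬝ᵥ (Qh *ᵥ x s)) J s := fun s J => by
    convert hasDerivWithinAt_dotProduct (hx' s J) (hy' s J) using 1
    have h1 : x s ⬝ᵥ (Ahᵀ *ᵥ y s) = (Ah *ᵥ x s) ⬝ᵥ y s := by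
      rw [Matrix.mulVec_transpose, dotProduct_comm, ← Matrix.dotProduct_mulVec, dotProduct_comm]
    rw [add_dotProduct, dotProduct_add, neg_dotProduct, h1, dotProduct_comm (G *ᵥ y s)]
    ring
  have hGn : ∀ s, 0 ≤ y s ⬝ᵥ (G *ᵥ y s) := fun s => by
    simpa using hG.dotProduct_mulVec_nonneg (y s)
  have hQn : ∀ s, 0 ≤ x s ⬝ᵥ (Qh *ᵥ x s) := fun s => by
    simpa using hQ.dotProduct_mulVec_nonneg (x s)
  have hmono : Monotone fun s => x s ⬝ᵥ y s :=
    monotone_of_hasDerivAt_nonneg (fun s => hasDerivWithinAt_univ.1 (hφ s Set.univ))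
      fun s => add_nonneg (hGn s) (hQn s)
  have hxt : x t = 0 := hξ
  have h0 : 0 ≤ x 0 ⬝ᵥ y 0 := by
    simpa [hx, hy, hX0, hY0] using hP.dotProduct_mulVec_nonneg ξ
  have hzero : ∀ s ∈ Set.Icc 0 t, x s ⬝ᵥ y s = 0 := fun s hs => by
    refine le_antisymm ((hmono hs.2).trans ?_) (h0.trans (hmono hs.1))
    simp [hxt]
  -- The derivative of the vanishing pairing is a sum of two nonnegative terms, so each is zero; a
  -- positive semidefinite form vanishes only on its kernel.
  have hGy : ∀ s ∈ Set.Icc 0 t, G *ᵥ y s = 0 := fun s hs => by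
    have h1 : HasDerivWithinAt (fun s => x s ⬝ᵥ y s) 0 (Set.Icc 0 t) s :=
      (hasDerivWithinAt_const s _ (0 : ℝ)).congr hzero (hzero s hs)
    have h2 := (uniqueDiffOn_Icc ht s hs).eq_deriv _ (hφ s _) h1
    have h3 : y s ⬝ᵥ (G *ᵥ y s) = 0 := by linarith [hGn s, hQn s]
    exact (hG.dotProduct_mulVec_zero_iff (y s)).1 (by simpa using h3)
  -- With `G y = 0` the first block decouples to `x' = -Ah x`. Reversed in time it starts from `x t
  -- = 0`, so it vanishes, and at reversed time `t` this says `ξ = x 0 = 0`.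
  have hback := eq_zero_of_linear_ode (F := fun _ => Ah) (v := fun s => x (t - s)) (t := t)
    continuousOn_const (fun s hs => by
      have hs' : t - s ∈ Set.Icc 0 t := ⟨by linarith [hs.2], by linarith [hs.1]⟩
      have := hasDerivWithinAt_comp_const_sub (hx' (t - s) (Set.Icc 0 t))
      simpa [hGy _ hs'] using this) (by simp [hxt]) t ⟨ht.le, le_rfl⟩
  simpa [hx, hX0] using hback

/-- Global solvability of the Riccati equation, with a fundamental matrix `X` of the closed-loop
equation. -/
lemma exists_riccati {Ah G Qh P₀ : Matrix (Fin r) (Fin r) ℝ} (hG : G.PosSemidef)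
    (hQ : Qh.PosSemidef) (hP : P₀.PosSemidef) :
    ∃ P X : ℝ → Matrix (Fin r) (Fin r) ℝ, P 0 = P₀ ∧ (∀ s, 0 ≤ s → (P s)ᵀ = P s) ∧
      (∀ s, 0 ≤ s → HasDerivWithinAt P (Ahᵀ * P s + P s * Ah - P s * G * P s + Qh)
        (Set.Ici 0) s) ∧
      ∀ s, 0 ≤ s → IsUnit (X s) ∧ HasDerivWithinAt X (-((Ah - G * P s) * X s)) (Set.Ici 0) s := by
  obtain ⟨Z, hZ0, hZ⟩ := exists_hasDerivWithinAt_eq_mul (Matrix.fromBlocks (-Ah) G Qh Ahᵀ)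
    (Matrix.fromRows (1 : Matrix (Fin r) (Fin r) ℝ) P₀)
  set X : ℝ → Matrix (Fin r) (Fin r) ℝ := fun s => (Z s).toRows₁ with hXdef
  set Y : ℝ → Matrix (Fin r) (Fin r) ℝ := fun s => (Z s).toRows₂ with hYdef
  have hXY : ∀ s, Matrix.fromBlocks (-Ah) G Qh Ahᵀ * Z s =
      Matrix.fromRows (-Ah * X s + G * Y s) (Qh * X s + Ahᵀ * Y s) := fun s => by
    conv_lhs => rw [← Matrix.fromRows_toRows (Z s)]
    rw [Matrix.fromBlocks_mul_fromRows]
  have hX0 : X 0 = 1 := by simp [hXdef, hZ0]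
  have hY0 : Y 0 = P₀ := by simp [hYdef, hZ0]
  have hX : ∀ s J, HasDerivWithinAt X (-Ah * X s + G * Y s) J s := fun s J => by
    rw [hasDerivWithinAt_matrix_iff]
    intro i j
    have := hasDerivWithinAt_matrix_iff.1 (hZ s J) (Sum.inl i) j
    rwa [hXY] at this
  have hY : ∀ s J, HasDerivWithinAt Y (Qh * X s + Ahᵀ * Y s) J s := fun s J => by
    rw [hasDerivWithinAt_matrix_iff]
    intro i j
    have := hasDerivWithinAt_matrix_iff.1 (hZ s J) (Sum.inr i) j
    rwa [hXY] at this
  have hu : ∀ s, 0 ≤ s → IsUnit (X s) := fun s hs =>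
    isUnit_of_hamiltonian hG hQ hP hX0 hY0 hX hY hs
  set P : ℝ → Matrix (Fin r) (Fin r) ℝ := fun s => Y s * (X s)⁻¹ with hPdef
  have hPX : ∀ s, 0 ≤ s → P s * X s = Y s := fun s hs => by
    rw [hPdef]
    exact Matrix.nonsing_inv_mul_cancel_right _ _ ((Matrix.isUnit_iff_isUnit_det _).1 (hu s hs))
  have hXX : ∀ s, 0 ≤ s → X s * (X s)⁻¹ = 1 := fun s hs =>
    Matrix.mul_nonsing_inv _ ((Matrix.isUnit_iff_isUnit_det _).1 (hu s hs))
  have hPd : ∀ s, 0 ≤ s → HasDerivWithinAt P (Ahᵀ * P s + P s * Ah - P s * G * P s + Qh)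
        (Set.Ici 0) s := fun s hs => by
    have h := hasDerivWithinAt_mul (hY s (Set.Ici 0))
      (hasDerivWithinAt_matrix_inv (hX s (Set.Ici 0)) (hu s hs))
    convert h using 1
    have e1 : (Qh * X s + Ahᵀ * Y s) * (X s)⁻¹ = Qh + Ahᵀ * P s := by
      rw [Matrix.add_mul, Matrix.mul_assoc, hXX s hs, Matrix.mul_one, Matrix.mul_assoc]
    have e2 : Y s * -((X s)⁻¹ * (-Ah * X s + G * Y s) * (X s)⁻¹) =
        P s * Ah - P s * G * P s := by
      have : (-Ah * X s + G * Y s) * (X s)⁻¹ = -Ah + G * P s := by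
        rw [Matrix.add_mul, Matrix.mul_assoc, hXX s hs, Matrix.mul_one, Matrix.mul_assoc]
      rw [Matrix.mul_assoc (X s)⁻¹, this]
      simp only [hPdef]
      noncomm_ring
    rw [e1, e2]
    noncomm_ring
  have hP0 : P 0 = P₀ := by simp [hPdef, hX0, hY0]
  refine ⟨P, X, hP0, fun s hs => ?_, hPd, fun s hs => ⟨hu s hs, ?_⟩⟩
  · have hsub : Set.Icc 0 s ⊆ Set.Ici 0 := Set.Icc_subset_Ici_self
    have hPt : ∀ a ∈ Set.Icc 0 s, HasDerivWithinAt (fun a => (P a)ᵀ)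
        (Ahᵀ * P a + P a * Ah - P a * G * P a + Qh)ᵀ (Set.Icc 0 s) a := fun a ha =>
      hasDerivWithinAt_transpose (hasDerivWithinAt_matrix_mono (hPd a ha.1) hsub)
    have hc : ContinuousOn P (Set.Icc 0 s) :=
      continuousOn_of_hasDerivWithinAt_matrix fun a ha =>
      hasDerivWithinAt_matrix_mono (hPd a ha.1) hsub
    have hGt : Gᵀ = G := by simpa using hG.isHermitian.eq
    have hQt : Qhᵀ = Qh := by simpa using hQ.isHermitian.eq
    have hPt0 : P₀ᵀ = P₀ := by simpa using hP.isHermitian.eq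
    -- Symmetry is needed to pass from the form `P G P` to the form `Kᵀ M K` of the equation. The
    -- defect `Pᵀ - P` solves a homogeneous Sylvester equation with these coefficients.
    have := eq_zero_of_sylvester (t := s) (W := fun a => (P a)ᵀ - P a)
      (U := fun a => Ahᵀ - (P a)ᵀ * G) (Z := fun a => Ah - G * P a)
      ((by fun_prop : Continuous fun M : Matrix (Fin r) (Fin r) ℝ => Ahᵀ - Mᵀ * G).comp_continuousOn
        hc)
      ((by fun_prop : Continuous fun M : Matrix (Fin r) (Fin r) ℝ => Ah - G * M).comp_continuousOn
        hc)
      (fun a ha => by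
        convert hasDerivWithinAt_matrix_sub (hPt a ha) (hasDerivWithinAt_matrix_mono (hPd a ha.1) hsub) using 1
        simp only [Matrix.transpose_add, Matrix.transpose_sub, Matrix.transpose_mul, hGt, hQt,
          Matrix.transpose_transpose]
        noncomm_ring)
      (by simp [hP0, hPt0]) s ⟨hs, le_rfl⟩
    exact sub_eq_zero.1 this
  · convert hX s (Set.Ici 0) using 1
    rw [← hPX s hs]
    noncomm_ring

end Riccati

/-! ### Gain, Riccati solution and closed loop for the associated ODE-LTI -/

section Gain

variable {c n m nh k : ℕ}

lemma dotProduct_weight_mulVec (Q : Matrix (Fin n) (Fin n) ℝ) (R : Matrix (Fin m) (Fin m) ℝ)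
    (w : Fin n ⊕ Fin m → ℝ) : w ⬝ᵥ (weight Q R *ᵥ w) =
      (fun i => w (Sum.inl i)) ⬝ᵥ (Q *ᵥ fun i => w (Sum.inl i)) +
        (fun j => w (Sum.inr j)) ⬝ᵥ (R *ᵥ fun j => w (Sum.inr j)) := by
  simp [weight, Matrix.fromBlocks_mulVec, dotProduct, Fintype.sum_sum_type, Function.comp_def]

lemma quadratic_nonneg {ι : Type} [Fintype ι] {S : Matrix ι ι ℝ} (hS : S.PosSemidef)
    (y : ι → ℝ) : 0 ≤ y ⬝ᵥ (S *ᵥ y) := by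
  simpa using hS.dotProduct_mulVec_nonneg y

lemma weight_posDef {Q : Matrix (Fin n) (Fin n) ℝ} {R : Matrix (Fin m) (Fin m) ℝ}
    (hQ : Q.PosDef) (hR : R.PosDef) : (weight Q R).PosDef := by
  refine .of_dotProduct_mulVec_pos ?_ fun x hx => ?_
  · exact Matrix.IsHermitian.fromBlocks hQ.isHermitian (by simp) hR.isHermitian
  · rw [star_trivial, dotProduct_weight_mulVec]
    have h1 := quadratic_nonneg hQ.posSemidef fun i => x (Sum.inl i)
    have h2 := quadratic_nonneg hR.posSemidef fun j => x (Sum.inr j)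
    by_cases hl : (fun i => x (Sum.inl i)) = 0
    · have hr : (fun j => x (Sum.inr j)) ≠ 0 := fun hr => hx <| by
        ext (i | j)
        exacts [congrFun hl i, congrFun hr j]
      have := hR.dotProduct_mulVec_pos hr
      rw [star_trivial] at this
      linarith
    · have := hQ.dotProduct_mulVec_pos hl
      rw [star_trivial] at this
      linarith

/-- Normalization of the input matrices of an associated ODE-LTI. -/
def InputNormalized (Bl : Matrix (Fin nh) (Fin k) ℝ) (Dl : Matrix (Fin n ⊕ Fin m) (Fin k) ℝ) :
    Prop :=
  (Dl = 0 ∧ Bl = 0 ∧ k = 1) ∨ Dl.rank = k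

variable {S : Matrix (Fin n ⊕ Fin m) (Fin n ⊕ Fin m) ℝ} {Al : Matrix (Fin nh) (Fin nh) ℝ}
  {Bl : Matrix (Fin nh) (Fin k) ℝ} {Cl : Matrix (Fin n ⊕ Fin m) (Fin nh) ℝ}
  {Dl : Matrix (Fin n ⊕ Fin m) (Fin k) ℝ}

lemma mulVec_injective_of_rank_eq {ι : Type} [Fintype ι] {D : Matrix ι (Fin k) ℝ}
    (h : D.rank = k) : Function.Injective D.mulVec := by
  rw [Matrix.mulVec_injective_iff, linearIndependent_iff_card_eq_finrank_span,
    Set.finrank, ← Matrix.rank_eq_finrank_span_cols, h, Fintype.card_fin]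

lemma InputNormalized.isUnit_or (hin : InputNormalized Bl Dl) (hS : S.PosDef) :
    (Dl = 0 ∧ Bl = 0) ∨ IsUnit (Dlᵀ * S * Dl).det := by
  rcases hin with h | h
  · exact .inl ⟨h.1, h.2.1⟩
  · right
    have := hS.conjTranspose_mul_mul_same (B := Dl) (mulVec_injective_of_rank_eq h)
    rw [conjTranspose_eq_transpose_of_trivial] at this
    exact (Matrix.isUnit_iff_isUnit_det _).1 this.isUnit

lemma InputNormalized.mul_eq_zero (hin : InputNormalized Bl Dl) {q : Fin k → ℝ}
    (hq : Dl *ᵥ q = 0) : Bl *ᵥ q = 0 := by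
  rcases hin with h | h
  · simp [h.2.1]
  · have : q = 0 := mulVec_injective_of_rank_eq h (by simpa using hq)
    simp [this]

/-- Removes the case distinction in the definition of the gain. When `Dl = 0`, either `Bl = 0` and
the right-hand factor vanishes, or `k = 0` and the matrices have no rows. -/
lemma InputNormalized.gain_eq (hin : InputNormalized Bl Dl) (P : Matrix (Fin nh) (Fin nh) ℝ) :
    gain S Bl Cl Dl P = (Dlᵀ * S * Dl)⁻¹ * (Blᵀ * P + Dlᵀ * S * Cl) := by
  by_cases hD : Dl = 0
  · rw [gain, if_neg (not_not.2 hD)]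
    rcases hin with h | h
    · simp [h.1, h.2.1]
    · have hk : k = 0 := by rw [← h, hD, Matrix.rank_zero]
      subst hk
      exact Subsingleton.elim _ _
  · rw [gain, if_pos hD]

lemma InputNormalized.mul_inv_mul (hin : InputNormalized Bl Dl) (hS : S.PosDef)
    (P : Matrix (Fin nh) (Fin nh) ℝ) :
    (Dlᵀ * S * Dl) * ((Dlᵀ * S * Dl)⁻¹ * (Blᵀ * P + Dlᵀ * S * Cl)) =
      Blᵀ * P + Dlᵀ * S * Cl := by
  rcases hin.isUnit_or hS with h | h
  · simp [h.1, h.2]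
  · exact Matrix.mul_nonsing_inv_cancel_left _ _ h

/-- This is the normal equation of the minimization over the input. It is the only property of the
gain that completing the square and Riccati uniqueness use, and it survives the degenerate case,
where both sides vanish. -/
lemma InputNormalized.mul_gain (hin : InputNormalized Bl Dl) (hS : S.PosDef)
    (P : Matrix (Fin nh) (Fin nh) ℝ) :
    (Dlᵀ * S * Dl) * gain S Bl Cl Dl P = Blᵀ * P + Dlᵀ * S * Cl := by
  rw [hin.gain_eq, hin.mul_inv_mul hS]

/-- Identifies the closed-loop matrix with `Ah - G P` of the Hamiltonian reduction. -/
lemma InputNormalized.sub_mul_gain (hin : InputNormalized Bl Dl)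
    (P : Matrix (Fin nh) (Fin nh) ℝ) :
    Al - Bl * gain S Bl Cl Dl P = Al - Bl * (Dlᵀ * S * Dl)⁻¹ * (Dlᵀ * S * Cl) -
      Bl * (Dlᵀ * S * Dl)⁻¹ * Blᵀ * P := by
  rw [hin.gain_eq]
  generalize (Dlᵀ * S * Dl)⁻¹ = Mi
  generalize Dlᵀ * S * Cl = N
  simp only [Matrix.mul_add, Matrix.mul_assoc]
  abel

lemma transpose_eq_of_posDef {ι : Type} [Fintype ι] {S : Matrix ι ι ℝ} (hS : S.PosDef) :
    Sᵀ = S := by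
  simpa using hS.isHermitian.eq

lemma transpose_gram (hS : S.PosDef) : (Dlᵀ * S * Dl)ᵀ = Dlᵀ * S * Dl := by
  simp [Matrix.transpose_mul, Matrix.mul_assoc, transpose_eq_of_posDef hS]

/-- No rank condition is needed: the inverse of a singular matrix is zero by convention. -/
lemma posSemidef_gram_inv (hS : S.PosDef) : (Dlᵀ * S * Dl)⁻¹.PosSemidef := by
  have := hS.posSemidef.conjTranspose_mul_mul_same Dl
  rw [conjTranspose_eq_transpose_of_trivial] at this
  exact this.inv

/-- With `M = Dlᵀ S Dl` and `N = Dlᵀ S Cl`, the Schur complement equals `(Cl - Dl M⁻¹ N)ᵀ S (Cl - Dl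
M⁻¹ N)`, the running cost after minimization over the input. -/
lemma InputNormalized.posSemidef_schur (hin : InputNormalized Bl Dl) (hS : S.PosDef) :
    (Clᵀ * S * Cl - (Dlᵀ * S * Cl)ᵀ * (Dlᵀ * S * Dl)⁻¹ * (Dlᵀ * S * Cl)).PosSemidef := by
  set N := Dlᵀ * S * Cl with hN
  set Mi := (Dlᵀ * S * Dl)⁻¹
  have h := hS.posSemidef.conjTranspose_mul_mul_same (Cl - Dl * (Mi * N))
  rw [conjTranspose_eq_transpose_of_trivial] at h
  convert h using 1
  have h1 : Dlᵀ * S * Dl * (Mi * N) = N := by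
    simpa using hin.mul_inv_mul (Cl := Cl) hS 0
  have h2 : Clᵀ * S * Dl = Nᵀ := by
    simp [hN, Matrix.transpose_mul, Matrix.mul_assoc, transpose_eq_of_posDef hS]
  have e1 : (Cl - Dl * (Mi * N))ᵀ * S * (Cl - Dl * (Mi * N)) =
      Clᵀ * S * Cl - (Clᵀ * S * Dl) * (Mi * N) - (Mi * N)ᵀ * (Dlᵀ * S * Cl) +
        (Mi * N)ᵀ * (Dlᵀ * S * Dl * (Mi * N)) := by
    simp only [Matrix.transpose_sub, Matrix.transpose_mul, Matrix.sub_mul, Matrix.mul_sub,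
      Matrix.mul_assoc]
    abel
  rw [e1, h1, h2, ← hN, Matrix.mul_assoc Nᵀ]
  abel

variable {E : Matrix (Fin c) (Fin n) ℝ} {Q : Matrix (Fin n) (Fin n) ℝ}
  {R : Matrix (Fin m) (Fin m) ℝ} {Q₀ : Matrix (Fin c) (Fin c) ℝ}

/-- Global solvability of the differential Riccati equation, together with a fundamental matrix of
the closed-loop equation in reversed time. -/
lemma InputNormalized.exists_riccatiSolution (hin : InputNormalized Bl Dl) (hQ : Q.PosDef)
    (hR : R.PosDef) (hQ₀ : Q₀.PosSemidef) :
    ∃ P X, IsRiccatiSolution E Q R Q₀ Al Bl Cl Dl (Set.Ici 0) P ∧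
      ∀ s, 0 ≤ s → IsUnit (X s) ∧ HasDerivWithinAt X
        (-((Al - Bl * gain (weight Q R) Bl Cl Dl (P s)) * X s)) (Set.Ici 0) s := by
  have hS := weight_posDef hQ hR
  set S := weight Q R
  set N := Dlᵀ * S * Cl with hN
  set M := Dlᵀ * S * Dl
  have hG : (Bl * M⁻¹ * Blᵀ).PosSemidef := by
    simpa using (posSemidef_gram_inv (Dl := Dl) hS).mul_mul_conjTranspose_same Bl
  have hP₀ : ((E * Cl.toRows₁)ᵀ * Q₀ * (E * Cl.toRows₁)).PosSemidef := by
    simpa using hQ₀.conjTranspose_mul_mul_same (E * Cl.toRows₁)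
  have hMi : M⁻¹ᵀ = M⁻¹ := by rw [Matrix.transpose_nonsing_inv, transpose_gram hS]
  have hQh : (Clᵀ * S * Cl - Nᵀ * M⁻¹ * N).PosSemidef := hin.posSemidef_schur hS
  obtain ⟨P, X, hP0, hPs, hP, hX⟩ := exists_riccati (Ah := Al - Bl * M⁻¹ * N) hG hQh hP₀
  refine ⟨P, X, ⟨hP0, fun s hs => ?_⟩, fun s hs => ⟨(hX s hs).1, ?_⟩⟩
  · convert hP s hs using 1
    rw [show weight Q R = S from rfl, Matrix.mul_assoc _ M, hin.mul_gain hS, hin.gain_eq, Matrix.transpose_mul, hMi,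
      Matrix.transpose_add, Matrix.transpose_mul, hPs s hs, ← hN]
    simp only [Matrix.transpose_sub, Matrix.transpose_mul, hMi, Matrix.transpose_transpose,
      Matrix.sub_mul, Matrix.mul_sub, Matrix.add_mul, Matrix.mul_add, Matrix.mul_assoc]
    abel
  · have : Al - Bl * gain S Bl Cl Dl (P s) = Al - Bl * M⁻¹ * N - Bl * M⁻¹ * Blᵀ * P s :=
      hin.sub_mul_gain _
    rw [this]
    exact (hX s hs).2

lemma IsRiccatiSolution.continuousOn {J : Set ℝ} {P : ℝ → Matrix (Fin nh) (Fin nh) ℝ}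
    (hP : IsRiccatiSolution E Q R Q₀ Al Bl Cl Dl J P) : ContinuousOn P J :=
  continuousOn_of_hasDerivWithinAt_matrix hP.deriv_eq

lemma InputNormalized.continuousOn_gain (hin : InputNormalized Bl Dl) {J : Set ℝ}
    {P : ℝ → Matrix (Fin nh) (Fin nh) ℝ} (hP : ContinuousOn P J) :
    ContinuousOn (fun s => gain S Bl Cl Dl (P s)) J := by
  simp only [hin.gain_eq]
  exact (by fun_prop : Continuous fun P : Matrix (Fin nh) (Fin nh) ℝ =>
    (Dlᵀ * S * Dl)⁻¹ * (Blᵀ * P + Dlᵀ * S * Cl)).comp_continuousOn hP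

/-- The terms `Kᵀ M K` and `Clᵀ S Cl` are symmetric whatever `P` is, so they cancel in the equation
for `Pᵀ - P`; a Sylvester equation with constant coefficients remains. -/
lemma IsRiccatiSolution.transpose_eq {t : ℝ} {P : ℝ → Matrix (Fin nh) (Fin nh) ℝ}
    (hQ : Q.PosDef) (hR : R.PosDef) (hQ₀ : Q₀.PosSemidef)
    (hP : IsRiccatiSolution E Q R Q₀ Al Bl Cl Dl (Set.Icc 0 t) P) :
    ∀ s ∈ Set.Icc 0 t, (P s)ᵀ = P s := by
  have hS := transpose_eq_of_posDef (weight_posDef hQ hR)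
  have hQt : Q₀ᵀ = Q₀ := by simpa using hQ₀.isHermitian.eq
  intro s hs
  have := eq_zero_of_sylvester (t := t) (W := fun a => (P a)ᵀ - P a)
    (U := fun _ => Alᵀ) (Z := fun _ => Al) continuousOn_const continuousOn_const
    (fun a ha => by
      convert hasDerivWithinAt_matrix_sub (hasDerivWithinAt_transpose (hP.deriv_eq a ha))
        (hP.deriv_eq a ha) using 1
      simp only [Matrix.transpose_add, Matrix.transpose_sub, Matrix.transpose_mul, hS,
        Matrix.transpose_transpose, Matrix.sub_mul, Matrix.mul_sub, Matrix.mul_assoc]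
      abel)
    (by simp [hP.init, Matrix.transpose_mul, Matrix.mul_assoc, hQt]) s hs
  exact sub_eq_zero.1 this

/-- Uniqueness for the differential Riccati equation. -/
lemma InputNormalized.riccatiSolution_unique (hin : InputNormalized Bl Dl) (hQ : Q.PosDef)
    (hR : R.PosDef) (hQ₀ : Q₀.PosSemidef) {t : ℝ} {P P' : ℝ → Matrix (Fin nh) (Fin nh) ℝ}
    (hP : IsRiccatiSolution E Q R Q₀ Al Bl Cl Dl (Set.Icc 0 t) P)
    (hP' : IsRiccatiSolution E Q R Q₀ Al Bl Cl Dl (Set.Icc 0 t) P') :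
    ∀ s ∈ Set.Icc 0 t, P s = P' s := by
  have hS := weight_posDef hQ hR
  set S := weight Q R
  set K : ℝ → Matrix (Fin k) (Fin nh) ℝ := fun s => gain S Bl Cl Dl (P s) with hK
  set K' : ℝ → Matrix (Fin k) (Fin nh) ℝ := fun s => gain S Bl Cl Dl (P' s) with hK'
  have hcK : ContinuousOn K (Set.Icc 0 t) := hin.continuousOn_gain hP.continuousOn
  have hcK' : ContinuousOn K' (Set.Icc 0 t) := hin.continuousOn_gain hP'.continuousOn
  intro s hs
  have := eq_zero_of_sylvester (t := t) (W := fun a => P a - P' a)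
    (U := fun a => Alᵀ - (K' a)ᵀ * Blᵀ) (Z := fun a => Al - Bl * K a)
    ((by fun_prop : Continuous fun M : Matrix (Fin k) (Fin nh) ℝ =>
      Alᵀ - Mᵀ * Blᵀ).comp_continuousOn hcK')
    ((by fun_prop : Continuous fun M : Matrix (Fin k) (Fin nh) ℝ =>
      Al - Bl * M).comp_continuousOn hcK)
    (fun a ha => by
      convert hasDerivWithinAt_matrix_sub (hP.deriv_eq a ha) (hP'.deriv_eq a ha) using 1
      have h1 : Dlᵀ * S * Dl * K a = Blᵀ * P a + Dlᵀ * S * Cl := hin.mul_gain hS _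
      have h2 : Dlᵀ * S * Dl * K' a = Blᵀ * P' a + Dlᵀ * S * Cl := hin.mul_gain hS _
      have h3 : (K a)ᵀ * (Dlᵀ * S * Dl) - (K' a)ᵀ * (Dlᵀ * S * Dl) = (P a - P' a) * Bl := by
        have := congrArg Matrix.transpose (congrArg₂ (· - ·) h1 h2)
        simpa [Matrix.transpose_mul, transpose_eq_of_posDef hS, hP.transpose_eq hQ hR hQ₀ a ha,
          hP'.transpose_eq hQ hR hQ₀ a ha, Matrix.sub_mul, Matrix.mul_assoc] using this
      -- Splitting `KᵀMK - K'ᵀMK' = (K - K')ᵀMK + K'ᵀM(K - K')` and using the normal equations makes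
      -- the quadratic term linear in `P - P'`, with continuous coefficients.
      have h4 : (K a)ᵀ * (Dlᵀ * S * Dl) * K a - (K' a)ᵀ * (Dlᵀ * S * Dl) * K' a =
          (P a - P' a) * Bl * K a + (K' a)ᵀ * (Blᵀ * (P a - P' a)) := by
        have h5 : Blᵀ * (P a - P' a) = Dlᵀ * S * Dl * K a - Dlᵀ * S * Dl * K' a := by
          rw [h1, h2, Matrix.mul_sub]; abel
        rw [h5, ← h3]
        simp only [Matrix.sub_mul, Matrix.mul_sub, Matrix.mul_assoc]
        abel
      have h6 := eq_add_of_sub_eq h4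
      simp only [hK, hK'] at h6 ⊢
      rw [h6]
      simp only [Matrix.sub_mul, Matrix.mul_sub, Matrix.mul_assoc]
      abel)
    (by simp [hP.init, hP'.init]) s hs
  exact sub_eq_zero.1 this

/-- Solvability of the closed-loop equation. -/
lemma InputNormalized.exists_closedLoop (hin : InputNormalized Bl Dl) (hQ : Q.PosDef)
    (hR : R.PosDef) (hQ₀ : Q₀.PosSemidef) {t : ℝ} (ht : 0 < t)
    {P : ℝ → Matrix (Fin nh) (Fin nh) ℝ}
    (hP : IsRiccatiSolution E Q R Q₀ Al Bl Cl Dl (Set.Icc 0 t) P) (v₀ : Fin nh → ℝ) :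
    ∃ v, IsClosedLoop Al Bl (fun s => gain (weight Q R) Bl Cl Dl (P s)) t v₀ v := by
  obtain ⟨P', X, hP', hX⟩ := hin.exists_riccatiSolution (E := E) (Al := Al) (Cl := Cl) hQ hR hQ₀
  have hsub : Set.Icc 0 t ⊆ Set.Ici 0 := Set.Icc_subset_Ici_self
  -- The fundamental matrix `X` belongs to the globally constructed solution `P'`; uniqueness
  -- transfers it to the given `P` on `[0,t]`.
  have heq := hin.riccatiSolution_unique hQ hR hQ₀ hP
    ⟨hP'.init, fun s hs => hasDerivWithinAt_matrix_mono (hP'.deriv_eq s hs.1) hsub⟩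
  -- Since `X` solves the closed-loop equation with reversed sign, `X (t - s)` solves it forwards;
  -- the factor `(X t)⁻¹` normalizes the initial value.
  refine ⟨fun s => X (t - s) *ᵥ ((X t)⁻¹ *ᵥ v₀), ?_, fun s hs => ?_⟩
  · have hu := (Matrix.isUnit_iff_isUnit_det _).1 (hX t ht.le).1
    simp [Matrix.mulVec_mulVec, Matrix.mul_nonsing_inv _ hu]
  · have hs' : t - s ∈ Set.Icc 0 t := ⟨by linarith [hs.2], by linarith [hs.1]⟩
    have h := hasDerivWithinAt_comp_const_sub (hasDerivWithinAt_mulVec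
      (hasDerivWithinAt_matrix_mono (hX (t - s) hs'.1).2 hsub)
      (hasDerivWithinAt_const (t - s) (Set.Icc 0 t) ((X t)⁻¹ *ᵥ v₀)))
    convert! h using 1
    rw [heq _ hs']
    simp [Matrix.neg_mulVec, Matrix.mulVec_mulVec, Matrix.mul_assoc]

end Gain

/-! ### Absolutely continuous functions -/

section AbsolutelyContinuous

variable {ι : Type} [Fintype ι] {a b : ℝ}

lemma absolutelyContinuousOnInterval_apply {f : ℝ → ι → ℝ}
    (hf : AbsolutelyContinuousOnInterval f a b) (i : ι) :
    AbsolutelyContinuousOnInterval (fun s => f s i) a b := by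
  refine squeeze_zero (fun _ => Finset.sum_nonneg fun _ _ => dist_nonneg) (fun _ => ?_) hf
  exact Finset.sum_le_sum fun _ _ => dist_le_pi_dist _ _ i

/-- The hypotheses are componentwise so that the lemma can be nested, as needed for `p ⬝ᵥ (P *ᵥ p)`.
-/
lemma absolutelyContinuousOnInterval_dotProduct {f g : ℝ → ι → ℝ}
    (hf : ∀ i, AbsolutelyContinuousOnInterval (fun s => f s i) a b)
    (hg : ∀ i, AbsolutelyContinuousOnInterval (fun s => g s i) a b) :
    AbsolutelyContinuousOnInterval (fun s => f s ⬝ᵥ g s) a b := by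
  classical
  simp only [dotProduct]
  induction (Finset.univ : Finset ι) using Finset.induction_on with
  | empty =>
    simpa using (contDiffOn_const (𝕜 := ℝ) (n := 1) (c := (0 : ℝ))
      (s := Set.uIcc a b)).absolutelyContinuousOnInterval
  | insert i s hi ih =>
    simp only [Finset.sum_insert hi]
    exact ((hf i).mul (hg i)).add ih

variable {F : Type} [NormedAddCommGroup F] [NormedSpace ℝ F]

lemma absolutelyContinuousOnInterval_of_hasDerivWithinAt {f f' : ℝ → F} (hab : a ≤ b)
    (hf : ∀ s ∈ Set.Icc a b, HasDerivWithinAt f (f' s) (Set.Icc a b) s)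
    (hc : ContinuousOn f' (Set.Icc a b)) : AbsolutelyContinuousOnInterval f a b := by
  obtain ⟨C, hC⟩ := isCompact_Icc.exists_bound_of_continuousOn hc
  have h := (convex_Icc a b).lipschitzOnWith_of_nnnorm_hasDerivWithin_le (C := C.toNNReal) hf
    fun s hs => by
      rw [← NNReal.coe_le_coe, coe_nnnorm]
      exact (hC s hs).trans (Real.le_coe_toNNReal C)
  rw [← Set.uIcc_of_le hab] at h
  exact h.absolutelyContinuousOnInterval

/-- An absolutely continuous function with a.e. continuous derivative is continuously
differentiable. -/
lemma hasDerivWithinAt_of_ae [CompleteSpace F] {f g : ℝ → F} (hab : a ≤ b)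
    (hf : AbsolutelyContinuousOnInterval f a b) (hg : ContinuousOn g (Set.Icc a b))
    (hd : ∀ᵐ s ∂(volume.restrict (Set.Icc a b)), HasDerivAt f (g s) s) :
    ∀ s ∈ Set.Icc a b, HasDerivWithinAt f (g s) (Set.Icc a b) s := by
  -- Extending `g` continuously to the line gives its primitive a two-sided derivative everywhere.
  -- Then `f` minus the primitive is absolutely continuous with derivative zero a.e., hence
  -- constant.
  set G : ℝ → F := Set.IccExtend hab ((Set.Icc a b).domRestrict g) with hG
  have hGc : Continuous G := (continuousOn_iff_continuous_domRestrict.1 hg).Icc_extend'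
  have hGg : ∀ s ∈ Set.Icc a b, G s = g s := fun s hs => by
    rw [hG, Set.IccExtend_of_mem _ _ hs, Set.domRestrict_apply]
  have hI : ∀ s, HasDerivAt (fun s => ∫ r in a..s, G r) (G s) s := fun s =>
    (hGc.integral_hasStrictDerivAt a s).hasDerivAt
  have hIac : AbsolutelyContinuousOnInterval (fun s => ∫ r in a..s, G r) a b :=
    absolutelyContinuousOnInterval_of_hasDerivWithinAt hab
      (fun s _ => (hI s).hasDerivWithinAt) hGc.continuousOn
  rw [ae_restrict_iff' measurableSet_Icc] at hd
  obtain ⟨C, hC⟩ := (hf.sub hIac).const_of_ae_hasDerivAt_zero (by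
    filter_upwards [hd] with s hs hs'
    rw [Set.uIcc_of_le hab] at hs'
    simpa [hGg s hs'] using (hs hs').sub (hI s))
  rw [Set.uIcc_of_le hab] at hC
  have hfe : ∀ s ∈ Set.Icc a b, f s = (∫ r in a..s, G r) + C := fun s hs => by
    rw [← hC s hs]; simp
  intro s hs
  rw [← hGg s hs]
  exact ((hI s).hasDerivWithinAt.add_const C).congr hfe (hfe s hs)

/-- If `V̇ + ℓ ≥ 0` a.e. then `V(a) - V(b) ≤ ∫ ℓ`. -/
lemma sub_le_integral_of_ae {V W ℓ : ℝ → ℝ} (hab : a ≤ b)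
    (hV : AbsolutelyContinuousOnInterval V a b) (hℓ : IntegrableOn ℓ (Set.Icc a b))
    (hd : ∀ᵐ s ∂(volume.restrict (Set.Icc a b)), HasDerivAt V (W s - ℓ s) s)
    (hW : ∀ s ∈ Set.Icc a b, 0 ≤ W s) :
    V a - V b ≤ ∫ s in a..b, ℓ s := by
  have h1 : IntervalIntegrable ℓ volume a b :=
    (intervalIntegrable_iff_integrableOn_Icc_of_le hab).2 hℓ
  -- The integrand equals `W` a.e. Integrability of `W` need not be assumed, because `deriv V` is
  -- integrable for absolutely continuous `V`.
  have h2 : 0 ≤ ∫ s in a..b, (deriv V s + ℓ s) := by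
    refine intervalIntegral.integral_nonneg_of_ae_restrict hab ?_
    filter_upwards [hd, ae_restrict_mem measurableSet_Icc] with s hs hs'
    simp [hs.deriv, hW s hs']
  rw [intervalIntegral.integral_add hV.intervalIntegrable_deriv h1,
    hV.integral_deriv_eq_sub] at h2
  linarith

end AbsolutelyContinuous

/-! ### From the DAE to the associated ODE-LTI and back -/

section DAE

variable {c n m nh k : ℕ} {E A : Matrix (Fin c) (Fin n) ℝ} {B : Matrix (Fin c) (Fin m) ℝ}
  {Al : Matrix (Fin nh) (Fin nh) ℝ} {Bl : Matrix (Fin nh) (Fin k) ℝ}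
  {Cl : Matrix (Fin n ⊕ Fin m) (Fin nh) ℝ} {Dl : Matrix (Fin n ⊕ Fin m) (Fin k) ℝ} {a b : ℝ}

lemma IsAC.continuousOn {ι : Type} [Fintype ι] {f : ℝ → ι → ℝ} (hab : a ≤ b)
    (hf : IsAC (Set.Icc a b) f) : ContinuousOn f (Set.Icc a b) := by
  have := (hf a b hab subset_rfl).continuousOn
  rwa [Set.uIcc_of_le hab] at this

lemma isAC_iff {ι : Type} [Fintype ι] {f : ℝ → ι → ℝ} (hab : a ≤ b) :
    IsAC (Set.Icc a b) f ↔ AbsolutelyContinuousOnInterval f a b := by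
  refine ⟨fun hf => hf a b hab subset_rfl, fun hf a' b' hab' hs => hf.mono ?_⟩
  rwa [Set.uIcc_of_le hab, Set.uIcc_of_le hab']

lemma IsAC.mono {ι : Type} [Fintype ι] {f : ℝ → ι → ℝ} {I J : Set ℝ} (hf : IsAC I f)
    (hJ : J ⊆ I) : IsAC J f :=
  fun a b hab hs => hf a b hab (hs.trans hJ)

lemma mulVec_output (hED : E * Dl.toRows₁ = 0) (p : Fin nh → ℝ) (q : Fin k → ℝ) :
    E *ᵥ (fun i => (Cl *ᵥ p + Dl *ᵥ q) (Sum.inl i)) = (E * Cl.toRows₁) *ᵥ p := by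
  have : (fun i => (Cl *ᵥ p + Dl *ᵥ q) (Sum.inl i)) = Cl.toRows₁ *ᵥ p + Dl.toRows₁ *ᵥ q := rfl
  rw [this, Matrix.mulVec_add, Matrix.mulVec_mulVec, Matrix.mulVec_mulVec, hED,
    Matrix.zero_mulVec, add_zero]

/-- Both sides are continuous and agree a.e., hence agree at every point, endpoints included. This
gives the initial and terminal values a meaning although `x` itself is only determined a.e. -/
lemma eq_mulVec_of_ae_eq (hED : E * Dl.toRows₁ = 0) (hab : a < b) {x : ℝ → Fin n → ℝ}
    {p : ℝ → Fin nh → ℝ} {q : ℝ → Fin k → ℝ} (hx : IsAC (Set.Icc a b) fun s => E *ᵥ x s)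
    (hp : IsAC (Set.Icc a b) p)
    (h : ∀ᵐ s ∂(volume.restrict (Set.Icc a b)),
      x s = fun i => (Cl *ᵥ p s + Dl *ᵥ q s) (Sum.inl i)) :
    ∀ s ∈ Set.Icc a b, E *ᵥ x s = (E * Cl.toRows₁) *ᵥ p s := by
  have hpc := hp.continuousOn hab.le
  refine Measure.eqOn_Icc_of_ae_eq volume hab.ne ?_ (hx.continuousOn hab.le) ?_
  · filter_upwards [h] with s hs
    rw [hs, mulVec_output hED]
  · exact (by fun_prop : Continuous fun y : Fin nh → ℝ =>
      (E * Cl.toRows₁) *ᵥ y).comp_continuousOn hpc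

/-- Full column rank makes `E C_s` injective, so it can be cancelled on the left in the first
Penrose equation. -/
lemma stateMap_mul (h : (E * Cl.toRows₁).rank = nh) :
    stateMap E Cl * (E * Cl.toRows₁) = 1 := by
  have h1 := (pinv_spec (E * Cl.toRows₁)).left
  have hinj := mulVec_injective_of_rank_eq h
  rw [← Matrix.toLin'.injective.eq_iff]
  refine LinearMap.ext fun y => hinj ?_
  simp only [Matrix.toLin'_apply, Matrix.one_mulVec, Matrix.mulVec_mulVec]
  rw [stateMap, ← Matrix.mul_assoc (E * Cl.toRows₁), h1]

lemma exists_Icc_subset {I : Set ℝ} (hI : IsTimeInterval I) (h0 : (0 : ℝ) ∈ I) :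
    ∃ a b, a < b ∧ (0 : ℝ) ∈ Set.Icc a b ∧ Set.Icc a b ⊆ I := by
  rcases hI with rfl | ⟨a, rfl⟩ | ⟨a, rfl⟩ | ⟨a, b, hab, rfl⟩
  · exact ⟨0, 1, one_pos, ⟨le_rfl, zero_le_one⟩, Set.subset_univ _⟩
  · exact ⟨0, 1, one_pos, ⟨le_rfl, zero_le_one⟩, fun s hs => le_trans h0 hs.1⟩
  · exact ⟨-1, 0, by norm_num, ⟨by norm_num, le_rfl⟩, fun s hs => le_trans hs.2 h0⟩
  · exact ⟨a, b, hab, h0, subset_rfl⟩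

lemma IsSolution.exists_trajectory (hA : IsAssociated E A B Al Bl Cl Dl) {I : Set ℝ}
    (hI : IsTimeInterval I) {x : ℝ → Fin n → ℝ} {u : ℝ → Fin m → ℝ}
    (h : IsSolution E A B I x u) :
    ∃ p q, IsODETrajectory Al Bl I p q ∧ ∀ᵐ s ∂(volume.restrict I),
      Sum.elim (x s) (u s) = Cl *ᵥ p s + Dl *ᵥ q s :=
  (hA.realization I hI).of_mem (fun s => Sum.elim (x s) (u s)) h

lemma eq_inl_of_elim_eq {x : Fin n → ℝ} {u : Fin m → ℝ} {w : Fin n ⊕ Fin m → ℝ}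
    (h : Sum.elim x u = w) : x = fun i => w (Sum.inl i) := by
  subst h; rfl

/-- A consistent `z` is `E C_s p(0)` for some trajectory `p`, hence lies in the range of `E C_s`, on
which `E C_s 𝓜` is the identity. -/
lemma mulVec_stateMap_of_mem (hA : IsAssociated E A B Al Bl Cl Dl) {z : Fin c → ℝ}
    (hz : z ∈ consistencySet E A B) : (E * Cl.toRows₁) *ᵥ (stateMap E Cl *ᵥ z) = z := by
  obtain ⟨I, hI, h0, x, u, hsol, rfl⟩ := hz
  obtain ⟨p, q, hpq, hw⟩ := hsol.exists_trajectory hA hI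
  obtain ⟨a, b, hab, h0', hsub⟩ := exists_Icc_subset hI h0
  have := eq_mulVec_of_ae_eq hA.E_Ds hab (hsol.Ex_ac.mono hsub) (hpq.p_ac.mono hsub)
    (by filter_upwards [ae_restrict_of_ae_restrict_of_subset hsub hw] with s hs
        exact eq_inl_of_elim_eq hs) 0 h0'
  rw [this, Matrix.mulVec_mulVec (p 0), stateMap_mul hA.rank_E_Cs, Matrix.one_mulVec]

/-- A realization yields elements of the behavior only up to null sets, whereas the optimal pair is
given by a pointwise formula. Continuity of `E x'` makes `E x'` and `E x` coincide everywhere. -/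
lemma IsSolution.congr_ae (hab : a < b) {x x' : ℝ → Fin n → ℝ} {u u' : ℝ → Fin m → ℝ}
    (h : IsSolution E A B (Set.Icc a b) x u) (hac : IsAC (Set.Icc a b) fun s => E *ᵥ x' s)
    (he : ∀ᵐ s ∂(volume.restrict (Set.Icc a b)), x' s = x s ∧ u' s = u s) :
    IsSolution E A B (Set.Icc a b) x' u' := by
  have hE : Set.EqOn (fun s => E *ᵥ x' s) (fun s => E *ᵥ x s) (Set.Icc a b) := by
    refine Measure.eqOn_Icc_of_ae_eq volume hab.ne ?_ (hac.continuousOn hab.le)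
      (h.Ex_ac.continuousOn hab.le)
    filter_upwards [he] with s hs
    rw [hs.1]
  have hx : x' =ᵐ[volume.restrict (Set.Icc a b)] x := he.mono fun s hs => hs.1
  have hu : u' =ᵐ[volume.restrict (Set.Icc a b)] u := he.mono fun s hs => hs.2
  refine ⟨?_, ?_, hac, fun t₀ ht₀ t ht htt => ?_⟩
  · have := h.x_loc.integrableOn_isCompact isCompact_Icc
    exact (IntegrableOn.congr_fun_ae this hx.symm).locallyIntegrableOn
  · have := h.u_loc.integrableOn_isCompact isCompact_Icc
    exact (IntegrableOn.congr_fun_ae this hu.symm).locallyIntegrableOn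
  · rw [show E *ᵥ x' t = E *ᵥ x t from hE ht, show E *ᵥ x' t₀ = E *ᵥ x t₀ from hE ht₀,
      h.eq t₀ ht₀ t ht htt]
    congr 1
    refine intervalIntegral.integral_congr_ae ?_
    rw [ae_restrict_iff' measurableSet_Icc] at he
    filter_upwards [he] with s hs hs'
    rw [Set.uIoc_of_le htt] at hs'
    obtain ⟨h1, h2⟩ := hs ⟨ht₀.1.trans hs'.1.le, hs'.2.trans ht.2⟩
    rw [h1, h2]

end DAE

/-! ### Completion of the square and the lower bound on the cost -/

section Cost

variable {c n m nh k : ℕ} {E A : Matrix (Fin c) (Fin n) ℝ} {B : Matrix (Fin c) (Fin m) ℝ}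
  {Q : Matrix (Fin n) (Fin n) ℝ} {R : Matrix (Fin m) (Fin m) ℝ} {Q₀ : Matrix (Fin c) (Fin c) ℝ}
  {Al : Matrix (Fin nh) (Fin nh) ℝ} {Bl : Matrix (Fin nh) (Fin k) ℝ}
  {Cl : Matrix (Fin n ⊕ Fin m) (Fin nh) ℝ} {Dl : Matrix (Fin n ⊕ Fin m) (Fin k) ℝ} {t : ℝ}

lemma dotProduct_mulVec_eq_transpose {ι κ : Type} [Fintype ι] [Fintype κ] (M : Matrix ι κ ℝ)
    (y : ι → ℝ) (w : κ → ℝ) : y ⬝ᵥ (M *ᵥ w) = (Mᵀ *ᵥ y) ⬝ᵥ w := by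
  rw [Matrix.dotProduct_mulVec, Matrix.mulVec_transpose]

lemma cost_eq_of_integrable (hQ : Q.PosDef) (hR : R.PosDef) (ht : 0 ≤ t)
    {x : ℝ → Fin n → ℝ} {u : ℝ → Fin m → ℝ}
    (hint : IntegrableOn (fun s => x s ⬝ᵥ (Q *ᵥ x s) + u s ⬝ᵥ (R *ᵥ u s)) (Set.Icc 0 t)) :
    cost E Q R Q₀ t x u = (((E *ᵥ x t) ⬝ᵥ (Q₀ *ᵥ (E *ᵥ x t)) +
      ∫ s in (0)..t, (x s ⬝ᵥ (Q *ᵥ x s) + u s ⬝ᵥ (R *ᵥ u s)) : ℝ) : EReal) := by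
  have hnn : ∀ s, 0 ≤ x s ⬝ᵥ (Q *ᵥ x s) + u s ⬝ᵥ (R *ᵥ u s) := fun s =>
    add_nonneg (quadratic_nonneg hQ.posSemidef _) (quadratic_nonneg hR.posSemidef _)
  rw [cost, ← ofReal_integral_eq_lintegral_ofReal hint (Filter.Eventually.of_forall hnn),
    EReal.coe_ennreal_ofReal, max_eq_left (integral_nonneg hnn), integral_Icc_eq_integral_Ioc,
    ← intervalIntegral.integral_of_le ht, ← EReal.coe_add]

lemma integrableOn_of_lintegral_ne_top (hQ : Q.PosDef) (hR : R.PosDef)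
    {x : ℝ → Fin n → ℝ} {u : ℝ → Fin m → ℝ} (hx : IsL1loc (Set.Icc 0 t) x)
    (hu : IsL1loc (Set.Icc 0 t) u)
    (h : ∫⁻ s in Set.Icc 0 t, ENNReal.ofReal (x s ⬝ᵥ (Q *ᵥ x s) + u s ⬝ᵥ (R *ᵥ u s)) ≠ ⊤) :
    IntegrableOn (fun s => x s ⬝ᵥ (Q *ᵥ x s) + u s ⬝ᵥ (R *ᵥ u s)) (Set.Icc 0 t) := by
  have hnn : ∀ s, 0 ≤ x s ⬝ᵥ (Q *ᵥ x s) + u s ⬝ᵥ (R *ᵥ u s) := fun s =>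
    add_nonneg (quadratic_nonneg hQ.posSemidef _) (quadratic_nonneg hR.posSemidef _)
  refine (lintegral_ofReal_ne_top_iff_integrable ?_ (Filter.Eventually.of_forall hnn)).1 h
  have hx' := (hx.integrableOn_isCompact isCompact_Icc).aestronglyMeasurable
  have hu' := (hu.integrableOn_isCompact isCompact_Icc).aestronglyMeasurable
  exact (by fun_prop : Continuous fun y : (Fin n → ℝ) × (Fin m → ℝ) =>
    y.1 ⬝ᵥ (Q *ᵥ y.1) + y.2 ⬝ᵥ (R *ᵥ y.2)).comp_aestronglyMeasurable (hx'.prodMk hu')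

/-- Completion of the square. -/
lemma InputNormalized.complete_square (hin : InputNormalized Bl Dl)
    {S : Matrix (Fin n ⊕ Fin m) (Fin n ⊕ Fin m) ℝ} (hS : S.PosDef)
    {P : Matrix (Fin nh) (Fin nh) ℝ} (hP : Pᵀ = P) (p : Fin nh → ℝ) (q : Fin k → ℝ) :
    (Al *ᵥ p + Bl *ᵥ q) ⬝ᵥ (P *ᵥ p) + p ⬝ᵥ (-(Alᵀ * P + P * Al
      - (gain S Bl Cl Dl P)ᵀ * (Dlᵀ * S * Dl) * gain S Bl Cl Dl P + Clᵀ * S * Cl) *ᵥ p +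
        P *ᵥ (Al *ᵥ p + Bl *ᵥ q)) =
    (q + gain S Bl Cl Dl P *ᵥ p) ⬝ᵥ ((Dlᵀ * S * Dl) *ᵥ (q + gain S Bl Cl Dl P *ᵥ p)) -
      (Cl *ᵥ p + Dl *ᵥ q) ⬝ᵥ (S *ᵥ (Cl *ᵥ p + Dl *ᵥ q)) := by
  have hSt := transpose_eq_of_posDef hS
  have hMK := congrArg (· *ᵥ p) (hin.mul_gain (Cl := Cl) hS P)
  -- From here on only the normal equation `hMK` for `K` is available.
  generalize gain S Bl Cl Dl P = K at *
  simp only [← Matrix.mulVec_mulVec, Matrix.add_mulVec] at hMK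
  have hMt : ∀ y w : Fin k → ℝ, y ⬝ᵥ (Dlᵀ *ᵥ S *ᵥ Dl *ᵥ w) = w ⬝ᵥ (Dlᵀ *ᵥ S *ᵥ Dl *ᵥ y) :=
    fun y w => by
      rw [dotProduct_mulVec_eq_transpose, dotProduct_mulVec_eq_transpose, hSt, Matrix.transpose_transpose,
        dotProduct_comm, dotProduct_mulVec_eq_transpose Dlᵀ w, Matrix.transpose_transpose]
  have e1 : (Al *ᵥ p) ⬝ᵥ (P *ᵥ p) = p ⬝ᵥ (Alᵀ *ᵥ P *ᵥ p) := by
    rw [dotProduct_mulVec_eq_transpose Alᵀ, Matrix.transpose_transpose]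
  have e2 : p ⬝ᵥ (P *ᵥ Bl *ᵥ q) = (Bl *ᵥ q) ⬝ᵥ (P *ᵥ p) := by
    rw [dotProduct_mulVec_eq_transpose P, hP, dotProduct_comm]
  have e3 : (Bl *ᵥ q) ⬝ᵥ (P *ᵥ p) = q ⬝ᵥ (Blᵀ *ᵥ P *ᵥ p) := by
    rw [dotProduct_mulVec_eq_transpose Blᵀ, Matrix.transpose_transpose]
  have e4 : p ⬝ᵥ (Kᵀ *ᵥ Dlᵀ *ᵥ S *ᵥ Dl *ᵥ K *ᵥ p) =
      (K *ᵥ p) ⬝ᵥ (Dlᵀ *ᵥ S *ᵥ Dl *ᵥ K *ᵥ p) := by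
    rw [dotProduct_mulVec_eq_transpose Kᵀ, Matrix.transpose_transpose]
  have e5 : p ⬝ᵥ (Clᵀ *ᵥ S *ᵥ Cl *ᵥ p) = (Cl *ᵥ p) ⬝ᵥ (S *ᵥ Cl *ᵥ p) := by
    rw [dotProduct_mulVec_eq_transpose Clᵀ, Matrix.transpose_transpose]
  have e6 : q ⬝ᵥ (Dlᵀ *ᵥ S *ᵥ Dl *ᵥ q) = (Dl *ᵥ q) ⬝ᵥ (S *ᵥ Dl *ᵥ q) := by
    rw [dotProduct_mulVec_eq_transpose Dlᵀ, Matrix.transpose_transpose]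
  have e7 : q ⬝ᵥ (Dlᵀ *ᵥ S *ᵥ Cl *ᵥ p) = (Dl *ᵥ q) ⬝ᵥ (S *ᵥ Cl *ᵥ p) := by
    rw [dotProduct_mulVec_eq_transpose Dlᵀ, Matrix.transpose_transpose]
  have e8 : (Cl *ᵥ p) ⬝ᵥ (S *ᵥ Dl *ᵥ q) = (Dl *ᵥ q) ⬝ᵥ (S *ᵥ Cl *ᵥ p) := by
    rw [dotProduct_mulVec_eq_transpose S, hSt, dotProduct_comm]
  have e9 : q ⬝ᵥ (Dlᵀ *ᵥ S *ᵥ Dl *ᵥ K *ᵥ p) =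
      q ⬝ᵥ (Blᵀ *ᵥ P *ᵥ p) + q ⬝ᵥ (Dlᵀ *ᵥ S *ᵥ Cl *ᵥ p) := by
    rw [hMK, dotProduct_add]
  simp only [← Matrix.mulVec_mulVec, Matrix.add_mulVec, Matrix.sub_mulVec, Matrix.neg_mulVec,
    Matrix.mulVec_add, dotProduct_add, add_dotProduct, dotProduct_neg, dotProduct_sub]
  rw [hMt (K *ᵥ p) q, e9, e1, e2, e3, e4, e5, e6, e7, e8]
  ring

/-- The derivative of the storage function `p(s)ᵀP(t-s)p(s)` along trajectories. -/
lemma InputNormalized.hasDerivWithinAt_storage (hin : InputNormalized Bl Dl) (hQ : Q.PosDef)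
    (hR : R.PosDef) (hQ₀ : Q₀.PosSemidef) {P : ℝ → Matrix (Fin nh) (Fin nh) ℝ}
    (hP : IsRiccatiSolution E Q R Q₀ Al Bl Cl Dl (Set.Icc 0 t) P) {p : ℝ → Fin nh → ℝ}
    {q : Fin k → ℝ} {s : ℝ} (hs : s ∈ Set.Icc 0 t)
    (hp : HasDerivWithinAt p (Al *ᵥ p s + Bl *ᵥ q) (Set.Icc 0 t) s) :
    HasDerivWithinAt (fun a => p a ⬝ᵥ (P (t - a) *ᵥ p a))
      ((q + gain (weight Q R) Bl Cl Dl (P (t - s)) *ᵥ p s) ⬝ᵥ ((Dlᵀ * weight Q R * Dl) *ᵥ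
        (q + gain (weight Q R) Bl Cl Dl (P (t - s)) *ᵥ p s)) -
      (Cl *ᵥ p s + Dl *ᵥ q) ⬝ᵥ (weight Q R *ᵥ (Cl *ᵥ p s + Dl *ᵥ q))) (Set.Icc 0 t) s := by
  have hs' : t - s ∈ Set.Icc 0 t := ⟨by linarith [hs.2], by linarith [hs.1]⟩
  have hPd := hasDerivWithinAt_matrix_iff.2 fun i j => hasDerivWithinAt_comp_const_sub
    (hasDerivWithinAt_matrix_iff.1 (hP.deriv_eq (t - s) hs') i j)
  convert hasDerivWithinAt_dotProduct hp (hasDerivWithinAt_mulVec hPd hp) using 1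
  exact (hin.complete_square (weight_posDef hQ hR) (hP.transpose_eq hQ hR hQ₀ _ hs') _ _).symm

lemma terminal_cost_eq {P₀ : Matrix (Fin nh) (Fin nh) ℝ}
    (hP : P₀ = (E * Cl.toRows₁)ᵀ * Q₀ * (E * Cl.toRows₁)) (p : Fin nh → ℝ) :
    p ⬝ᵥ (P₀ *ᵥ p) = ((E * Cl.toRows₁) *ᵥ p) ⬝ᵥ (Q₀ *ᵥ ((E * Cl.toRows₁) *ᵥ p)) := by
  rw [hP, ← Matrix.mulVec_mulVec, ← Matrix.mulVec_mulVec,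
    dotProduct_mulVec_eq_transpose (E * Cl.toRows₁)ᵀ, Matrix.transpose_transpose]

lemma isTimeInterval_Icc (ht : 0 < t) : IsTimeInterval (Set.Icc 0 t) :=
  .inr (.inr (.inr ⟨0, t, ht, rfl⟩))

lemma IsAssociated.inputNormalized (hA : IsAssociated E A B Al Bl Cl Dl) :
    InputNormalized Bl Dl :=
  hA.input

/-- The value of the Riccati solution bounds the cost of admissible pairs from below. -/
lemma IsAdmissible.le_cost (hA : IsAssociated E A B Al Bl Cl Dl) (hQ : Q.PosDef)
    (hR : R.PosDef) (hQ₀ : Q₀.PosSemidef) (ht : 0 < t) {P : ℝ → Matrix (Fin nh) (Fin nh) ℝ}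
    (hP : IsRiccatiSolution E Q R Q₀ Al Bl Cl Dl (Set.Icc 0 t) P) {z : Fin c → ℝ}
    {x : ℝ → Fin n → ℝ} {u : ℝ → Fin m → ℝ} (h : IsAdmissible E A B z t x u) :
    (((stateMap E Cl *ᵥ z) ⬝ᵥ (P t *ᵥ (stateMap E Cl *ᵥ z)) : ℝ) : EReal) ≤
      cost E Q R Q₀ t x u := by
  have hin := hA.inputNormalized
  have hS := weight_posDef hQ hR
  obtain ⟨p, q, hpq, hw⟩ := h.1.exists_trajectory hA (isTimeInterval_Icc ht)
  have hEx := eq_mulVec_of_ae_eq hA.E_Ds ht h.1.Ex_ac hpq.p_ac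
    (hw.mono fun s hs => eq_inl_of_elim_eq hs)
  have hp0 : p 0 = stateMap E Cl *ᵥ z := by
    rw [← h.2, hEx 0 ⟨le_rfl, ht.le⟩, Matrix.mulVec_mulVec, stateMap_mul hA.rank_E_Cs,
      Matrix.one_mulVec]
  -- An infinite running cost satisfies the bound trivially; a finite one makes the integrand
  -- integrable, so the energy inequality applies.
  by_cases htop :
      ∫⁻ s in Set.Icc 0 t, ENNReal.ofReal (x s ⬝ᵥ (Q *ᵥ x s) + u s ⬝ᵥ (R *ᵥ u s)) = ⊤
  · rw [cost, htop, EReal.coe_ennreal_top, EReal.coe_add_top]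
    exact le_top
  have hint := integrableOn_of_lintegral_ne_top hQ hR h.1.x_loc h.1.u_loc htop
  rw [cost_eq_of_integrable hQ hR ht.le hint, EReal.coe_le_coe_iff]
  have hpac := (isAC_iff ht.le).1 hpq.p_ac
  -- The input is only locally integrable, so the storage function is merely absolutely continuous
  -- and the energy balance holds a.e. only.
  have hPac : ∀ i j, AbsolutelyContinuousOnInterval (fun s => P (t - s) i j) 0 t := by
    intro i j
    have hPij := fun s hs => hasDerivWithinAt_matrix_iff.1 (hP.deriv_eq s hs) i j
    have hc : ContinuousOn (fun s => (Alᵀ * P s + P s * Al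
        - (gain (weight Q R) Bl Cl Dl (P s))ᵀ * (Dlᵀ * weight Q R * Dl) *
            gain (weight Q R) Bl Cl Dl (P s)
        + Clᵀ * weight Q R * Cl) i j) (Set.Icc 0 t) := by
      simp only [hin.gain_eq]
      exact (by fun_prop : Continuous fun P : Matrix (Fin nh) (Fin nh) ℝ =>
        (Alᵀ * P + P * Al - ((Dlᵀ * weight Q R * Dl)⁻¹ * (Blᵀ * P + Dlᵀ * weight Q R * Cl))ᵀ *
          (Dlᵀ * weight Q R * Dl) * ((Dlᵀ * weight Q R * Dl)⁻¹ *
          (Blᵀ * P + Dlᵀ * weight Q R * Cl)) + Clᵀ * weight Q R * Cl) i j).comp_continuousOn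
            hP.continuousOn
    have hmaps : Set.MapsTo (fun s => t - s) (Set.Icc 0 t) (Set.Icc 0 t) :=
      fun s hs => ⟨by linarith [hs.2], by linarith [hs.1]⟩
    exact absolutelyContinuousOnInterval_of_hasDerivWithinAt ht.le
      (fun s hs => hasDerivWithinAt_comp_const_sub (hPij (t - s) (hmaps hs)))
      (hc.comp (by fun_prop) hmaps).neg
  have hVac : AbsolutelyContinuousOnInterval (fun s => p s ⬝ᵥ (P (t - s) *ᵥ p s)) 0 t :=
    absolutelyContinuousOnInterval_dotProduct
      (fun i => absolutelyContinuousOnInterval_apply hpac i) fun i =>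
        absolutelyContinuousOnInterval_dotProduct (hPac i) fun j =>
          absolutelyContinuousOnInterval_apply hpac j
  have hle := sub_le_integral_of_ae (W := fun s =>
      (q s + gain (weight Q R) Bl Cl Dl (P (t - s)) *ᵥ p s) ⬝ᵥ ((Dlᵀ * weight Q R * Dl) *ᵥ
        (q s + gain (weight Q R) Bl Cl Dl (P (t - s)) *ᵥ p s))) ht.le hVac hint ?_ ?_
  · simp only [sub_zero, sub_self] at hle
    rw [hEx t ⟨ht.le, le_rfl⟩, ← terminal_cost_eq hP.init, ← hp0]
    linarith
  · have hIoo : ∀ᵐ s ∂(volume.restrict (Set.Icc 0 t)), s ∈ Set.Ioo 0 t := by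
      rw [← restrict_Ioo_eq_restrict_Icc]
      exact ae_restrict_mem measurableSet_Ioo
    filter_upwards [hIoo, hpq.deriv_eq, hw] with s hs hps hws
    have hs' := Set.Ioo_subset_Icc_self hs
    have hd := (hin.hasDerivWithinAt_storage hQ hR hQ₀ hP hs' hps.hasDerivWithinAt).hasDerivAt
      (Icc_mem_nhds hs.1 hs.2)
    rwa [← hws, dotProduct_weight_mulVec] at hd
  · intro s _
    refine quadratic_nonneg ?_ _
    simpa using hS.posSemidef.conjTranspose_mul_mul_same Dl

end Cost

/-! ### The optimal closed loop and the augmented system -/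

section ClosedLoop

variable {c n m nh k : ℕ} {E A : Matrix (Fin c) (Fin n) ℝ} {B : Matrix (Fin c) (Fin m) ℝ}
  {Q : Matrix (Fin n) (Fin n) ℝ} {R : Matrix (Fin m) (Fin m) ℝ} {Q₀ : Matrix (Fin c) (Fin c) ℝ}
  {Al : Matrix (Fin nh) (Fin nh) ℝ} {Bl : Matrix (Fin nh) (Fin k) ℝ}
  {Cl : Matrix (Fin n ⊕ Fin m) (Fin nh) ℝ} {Dl : Matrix (Fin n ⊕ Fin m) (Fin k) ℝ} {t : ℝ}
  {K : ℝ → Matrix (Fin k) (Fin nh) ℝ} {z : Fin c → ℝ} {v : ℝ → Fin nh → ℝ}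

lemma output_feedback {ι : Type} (C : Matrix ι (Fin nh) ℝ) (D : Matrix ι (Fin k) ℝ)
    (K : Matrix (Fin k) (Fin nh) ℝ) (p : Fin nh → ℝ) :
    (C - D * K) *ᵥ p = C *ᵥ p + D *ᵥ (-(K *ᵥ p)) := by
  rw [Matrix.sub_mulVec, Matrix.mulVec_neg, Matrix.mulVec_mulVec, sub_eq_add_neg]

lemma continuousOn_comp_const_sub {X : Type} [TopologicalSpace X] {f : ℝ → X}
    (hf : ContinuousOn f (Set.Icc 0 t)) : ContinuousOn (fun s => f (t - s)) (Set.Icc 0 t) :=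
  hf.comp (by fun_prop) fun s hs => ⟨by linarith [hs.2], by linarith [hs.1]⟩

lemma mulVec_output_feedback (hED : E * Dl.toRows₁ = 0) (K : Matrix (Fin k) (Fin nh) ℝ)
    (p : Fin nh → ℝ) :
    E *ᵥ (fun i => ((Cl - Dl * K) *ᵥ p) (Sum.inl i)) = (E * Cl.toRows₁) *ᵥ p := by
  simp only [output_feedback]
  exact mulVec_output hED _ _

lemma IsClosedLoop.continuousOn (hv : IsClosedLoop Al Bl K t (stateMap E Cl *ᵥ z) v) :
    ContinuousOn v (Set.Icc 0 t) :=
  fun s hs => (hv.deriv_eq s hs).continuousWithinAt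

lemma IsClosedLoop.continuousOn_input (hK : ContinuousOn K (Set.Icc 0 t))
    (hv : IsClosedLoop Al Bl K t (stateMap E Cl *ᵥ z) v) :
    ContinuousOn (fun s => -(K (t - s) *ᵥ v s)) (Set.Icc 0 t) :=
  (by fun_prop : Continuous fun y : Matrix (Fin k) (Fin nh) ℝ × (Fin nh → ℝ) =>
    -(y.1 *ᵥ y.2)).comp_continuousOn ((continuousOn_comp_const_sub hK).prodMk hv.continuousOn)

lemma IsClosedLoop.hasDerivWithinAt (hv : IsClosedLoop Al Bl K t (stateMap E Cl *ᵥ z) v)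
    {s : ℝ} (hs : s ∈ Set.Icc 0 t) :
    HasDerivWithinAt v (Al *ᵥ v s + Bl *ᵥ (-(K (t - s) *ᵥ v s))) (Set.Icc 0 t) s := by
  rw [← output_feedback]
  exact hv.deriv_eq s hs

lemma IsClosedLoop.trajectory (ht : 0 < t) (hK : ContinuousOn K (Set.Icc 0 t))
    (hv : IsClosedLoop Al Bl K t (stateMap E Cl *ᵥ z) v) :
    IsODETrajectory Al Bl (Set.Icc 0 t) v fun s => -(K (t - s) *ᵥ v s) := by
  have hq := hv.continuousOn_input hK
  refine ⟨(isAC_iff ht.le).2 <| absolutelyContinuousOnInterval_of_hasDerivWithinAt ht.le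
    (fun s hs => hv.hasDerivWithinAt hs) ?_, hq.locallyIntegrableOn measurableSet_Icc, ?_⟩
  · exact (by fun_prop : Continuous fun y : (Fin nh → ℝ) × (Fin k → ℝ) =>
      Al *ᵥ y.1 + Bl *ᵥ y.2).comp_continuousOn (hv.continuousOn.prodMk hq)
  · rw [← restrict_Ioo_eq_restrict_Icc]
    filter_upwards [ae_restrict_mem measurableSet_Ioo] with s hs
    exact (hv.hasDerivWithinAt (Set.Ioo_subset_Icc_self hs)).hasDerivAt (Icc_mem_nhds hs.1 hs.2)

/-- The closed-loop output is admissible. -/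
lemma IsClosedLoop.admissible (hA : IsAssociated E A B Al Bl Cl Dl) (ht : 0 < t)
    (hK : ContinuousOn K (Set.Icc 0 t)) (hz : z ∈ consistencySet E A B)
    (hv : IsClosedLoop Al Bl K t (stateMap E Cl *ᵥ z) v) :
    IsAdmissible E A B z t (fun s i => ((Cl - Dl * K (t - s)) *ᵥ v s) (Sum.inl i))
      (fun s j => ((Cl - Dl * K (t - s)) *ᵥ v s) (Sum.inr j)) := by
  have htr := hv.trajectory ht hK
  obtain ⟨w, hw, hwe⟩ := (hA.realization _ (isTimeInterval_Icc ht)).exists_mem _ _ htr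
  have hE : ∀ s, E *ᵥ (fun i => ((Cl - Dl * K (t - s)) *ᵥ v s) (Sum.inl i)) =
      (E * Cl.toRows₁) *ᵥ v s := fun s => mulVec_output_feedback hA.E_Ds _ _
  constructor
  · refine IsSolution.congr_ae ht hw ?_ ?_
    · simp only [hE]
      refine (isAC_iff ht.le).2 <| absolutelyContinuousOnInterval_of_hasDerivWithinAt ht.le
        (fun s hs => hasDerivWithinAt_mulVec (hasDerivWithinAt_matrix_iff.2 fun i j =>
          hasDerivWithinAt_const s _ ((E * Cl.toRows₁) i j)) (hv.hasDerivWithinAt hs)) ?_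
      -- The zero matrix is the derivative of the constant factor, as it appears in the product
      -- rule.
      exact (by fun_prop : Continuous fun y : (Fin nh → ℝ) × (Fin k → ℝ) =>
        (fun _ _ => 0 : Matrix (Fin c) (Fin nh) ℝ) *ᵥ y.1 +
          (E * Cl.toRows₁) *ᵥ (Al *ᵥ y.1 + Bl *ᵥ y.2)).comp_continuousOn
            (hv.continuousOn.prodMk (hv.continuousOn_input hK))
    · filter_upwards [hwe] with s hs
      simp only [output_feedback, hs, and_self]
  · rw [hE, hv.init, mulVec_stateMap_of_mem hA hz]

/-- The cost of the closed-loop output is the value of the Riccati solution. -/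
lemma IsClosedLoop.cost_eq (hA : IsAssociated E A B Al Bl Cl Dl) (hQ : Q.PosDef)
    (hR : R.PosDef) (hQ₀ : Q₀.PosSemidef) (ht : 0 < t) {P : ℝ → Matrix (Fin nh) (Fin nh) ℝ}
    (hP : IsRiccatiSolution E Q R Q₀ Al Bl Cl Dl (Set.Icc 0 t) P)
    (hK : K = fun s => gain (weight Q R) Bl Cl Dl (P s))
    (hv : IsClosedLoop Al Bl K t (stateMap E Cl *ᵥ z) v) :
    cost E Q R Q₀ t (fun s i => ((Cl - Dl * K (t - s)) *ᵥ v s) (Sum.inl i))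
      (fun s j => ((Cl - Dl * K (t - s)) *ᵥ v s) (Sum.inr j)) =
    (((stateMap E Cl *ᵥ z) ⬝ᵥ (P t *ᵥ (stateMap E Cl *ᵥ z)) : ℝ) : EReal) := by
  have hin := hA.inputNormalized
  have hKc : ContinuousOn K (Set.Icc 0 t) := by
    rw [hK]; exact hin.continuousOn_gain hP.continuousOn
  have hw : ContinuousOn (fun s => (Cl - Dl * K (t - s)) *ᵥ v s) (Set.Icc 0 t) := by
    simp only [output_feedback]
    exact (by fun_prop : Continuous fun y : (Fin nh → ℝ) × (Fin k → ℝ) =>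
      Cl *ᵥ y.1 + Dl *ᵥ y.2).comp_continuousOn (hv.continuousOn.prodMk (hv.continuousOn_input hKc))
  have hcont := (by fun_prop : Continuous fun y : Fin n ⊕ Fin m → ℝ =>
    y ⬝ᵥ (weight Q R *ᵥ y)).comp_continuousOn hw
  -- With input `-K v` the square vanishes, so the storage function decreases exactly at the rate of
  -- the running cost.
  have hd : ∀ s ∈ Set.Icc 0 t, HasDerivWithinAt (fun a => v a ⬝ᵥ (P (t - a) *ᵥ v a))
      (-(((Cl - Dl * K (t - s)) *ᵥ v s) ⬝ᵥ (weight Q R *ᵥ ((Cl - Dl * K (t - s)) *ᵥ v s))))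
      (Set.Icc 0 t) s := fun s hs => by
    have h := hin.hasDerivWithinAt_storage hQ hR hQ₀ hP hs (hv.hasDerivWithinAt hs)
    rw [← output_feedback] at h
    simpa [hK] using h
  have hint := intervalIntegral.integral_eq_sub_of_hasDerivAt_of_le ht.le
    (fun s hs => (hd s hs).continuousWithinAt)
    (fun s hs => (hd s (Set.Ioo_subset_Icc_self hs)).hasDerivAt (Icc_mem_nhds hs.1 hs.2))
    (hcont.neg.intervalIntegrable_of_Icc ht.le)
  simp only [dotProduct_weight_mulVec] at hcont hint
  rw [cost_eq_of_integrable hQ hR ht.le (hcont.integrableOn_Icc),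
    mulVec_output_feedback hA.E_Ds, ← terminal_cost_eq hP.init]
  rw [intervalIntegral.integral_neg] at hint
  simp only [sub_self, sub_zero, hv.init] at hint
  congr 1
  linarith

/-- The closed-loop output has the state-space form `w = (C_l - D_l K) 𝓜 E x`. -/
lemma stateMap_mulVec_output (hA : IsAssociated E A B Al Bl Cl Dl)
    (K : Matrix (Fin k) (Fin nh) ℝ) (p : Fin nh → ℝ) :
    (stateMap E Cl * E) *ᵥ (fun i => ((Cl - Dl * K) *ᵥ p) (Sum.inl i)) = p := by
  rw [← Matrix.mulVec_mulVec, mulVec_output_feedback hA.E_Ds, Matrix.mulVec_mulVec,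
    stateMap_mul hA.rank_E_Cs, Matrix.one_mulVec]

/-- `K₁` and `K₂` are built so that `K₁ x + K₂ u` is the feedback output minus the pair `(x, u)`. -/
lemma augmented_constraint_iff {s : ℝ} (x : Fin n → ℝ) (u : Fin m → ℝ) :
    K₁ E Cl Dl K t s *ᵥ x + K₂ n m *ᵥ u = 0 ↔
      Sum.elim x u = (Cl - Dl * K (t - s)) *ᵥ ((stateMap E Cl * E) *ᵥ x) := by
  have h : K₁ E Cl Dl K t s *ᵥ x + K₂ n m *ᵥ u =
      (Cl - Dl * K (t - s)) *ᵥ ((stateMap E Cl * E) *ᵥ x) - Sum.elim x u := by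
    rw [K₁, K₂, Matrix.sub_mulVec, Matrix.mulVec_mulVec, Matrix.mul_assoc, sub_add, sub_right_inj]
    ext (i | j) <;> simp [Matrix.fromRows_mulVec, Matrix.neg_mulVec]
  rw [h, sub_eq_zero, eq_comm]

/-- Solutions of the augmented system agree a.e. with the closed-loop output. -/
lemma IsClosedLoop.ae_eq (hA : IsAssociated E A B Al Bl Cl Dl) (ht : 0 < t)
    (hK : ContinuousOn K (Set.Icc 0 t))
    (hv : IsClosedLoop Al Bl K t (stateMap E Cl *ᵥ z) v)
    {x : ℝ → Fin n → ℝ} {u : ℝ → Fin m → ℝ} (hz : E *ᵥ x 0 = z)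
    (h : IsAugmentedSolution E A B Cl Dl K t x u) :
    ∀ᵐ s ∂(volume.restrict (Set.Icc 0 t)),
      Sum.elim (x s) (u s) = (Cl - Dl * K (t - s)) *ᵥ v s := by
  obtain ⟨hsol, haug⟩ := h
  obtain ⟨p, q, hpq, hw⟩ := hsol.exists_trajectory hA (isTimeInterval_Icc ht)
  have hEx := eq_mulVec_of_ae_eq hA.E_Ds ht hsol.Ex_ac hpq.p_ac
    (hw.mono fun s hs => eq_inl_of_elim_eq hs)
  have hp : ∀ s ∈ Set.Icc 0 t, (stateMap E Cl * E) *ᵥ x s = p s := fun s hs => by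
    rw [← Matrix.mulVec_mulVec, hEx s hs, Matrix.mulVec_mulVec, stateMap_mul hA.rank_E_Cs,
      Matrix.one_mulVec]
  have hpc := hpq.p_ac.continuousOn ht.le
  have hF : ContinuousOn (fun s => Al - Bl * K (t - s)) (Set.Icc 0 t) :=
    (by fun_prop : Continuous fun M : Matrix (Fin k) (Fin nh) ℝ =>
      Al - Bl * M).comp_continuousOn (continuousOn_comp_const_sub hK)
  have hpd := hasDerivWithinAt_of_ae ht.le ((isAC_iff ht.le).1 hpq.p_ac)
    (g := fun s => (Al - Bl * K (t - s)) *ᵥ p s)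
    ((by fun_prop : Continuous fun y : Matrix (Fin nh) (Fin nh) ℝ × (Fin nh → ℝ) =>
      y.1 *ᵥ y.2).comp_continuousOn (hF.prodMk hpc)) (by
    filter_upwards [hpq.deriv_eq, hw, haug, ae_restrict_mem measurableSet_Icc]
      with s h1 h2 h3 hs
    rw [augmented_constraint_iff, hp s hs, h2, output_feedback] at h3
    -- The constraint gives the output as `Cl p - Dl K p`, the realization as `Cl p + Dl q`. So `q +
    -- K p` lies in the kernel of `Dl`, which is contained in that of `Bl`; hence `q` may be
    -- replaced by `-K p` in the state equation.
    have h4 : Dl *ᵥ (q s + K (t - s) *ᵥ p s) = 0 := by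
      rw [Matrix.mulVec_neg] at h3
      rw [Matrix.mulVec_add, add_left_cancel h3, neg_add_cancel]
    have h5 := hA.inputNormalized.mul_eq_zero h4
    rw [Matrix.mulVec_add] at h5
    rw [output_feedback, Matrix.mulVec_neg, ← eq_neg_of_add_eq_zero_left h5]
    exact h1)
  -- Both states solve the same linear equation with initial value `𝓜 z`.
  have hpv := eq_zero_of_linear_ode (v := fun s => p s - v s) hF (fun s hs => by
    rw [Matrix.mulVec_sub]
    exact (hpd s hs).sub (hv.deriv_eq s hs)) (by
      rw [hv.init, ← hz, ← hp 0 ⟨le_rfl, ht.le⟩, Matrix.mulVec_mulVec, sub_self])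
  filter_upwards [haug, ae_restrict_mem measurableSet_Icc] with s h1 hs
  rw [augmented_constraint_iff, hp s hs] at h1
  rw [h1, sub_eq_zero.1 (hpv s hs)]

end ClosedLoop

end DaeLQ

/-! ### Assembly of the theorem -/

theorem mainTheorem6 {c n m nh k : ℕ}
    (E A : Matrix (Fin c) (Fin n) ℝ) (B : Matrix (Fin c) (Fin m) ℝ)
    (Q : Matrix (Fin n) (Fin n) ℝ) (R : Matrix (Fin m) (Fin m) ℝ) (Q₀ : Matrix (Fin c) (Fin c) ℝ)
    (hQ : Q.PosDef) (hR : R.PosDef) (hQ₀ : Q₀.PosSemidef)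
    (Al : Matrix (Fin nh) (Fin nh) ℝ) (Bl : Matrix (Fin nh) (Fin k) ℝ)
    (Cl : Matrix (Fin n ⊕ Fin m) (Fin nh) ℝ) (Dl : Matrix (Fin n ⊕ Fin m) (Fin k) ℝ)
    (hS : DaeLQ.IsAssociated E A B Al Bl Cl Dl) :
    -- the Riccati equation has a solution on `[0,∞)`
    (∃ P, DaeLQ.IsRiccatiSolution E Q R Q₀ Al Bl Cl Dl (Set.Ici 0) P) ∧
    ∀ t : ℝ, 0 < t →
      -- its solution on `[0,t]` is unique
      (∀ P P', DaeLQ.IsRiccatiSolution E Q R Q₀ Al Bl Cl Dl (Set.Icc 0 t) P →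
        DaeLQ.IsRiccatiSolution E Q R Q₀ Al Bl Cl Dl (Set.Icc 0 t) P' →
        ∀ s ∈ Set.Icc 0 t, P s = P' s) ∧
      ∀ P, DaeLQ.IsRiccatiSolution E Q R Q₀ Al Bl Cl Dl (Set.Icc 0 t) P →
      ∀ z ∈ DaeLQ.consistencySet E A B,
        let K : ℝ → Matrix (Fin k) (Fin nh) ℝ :=
          fun s => DaeLQ.gain (DaeLQ.weight Q R) Bl Cl Dl (P s)
        let Mz : Fin nh → ℝ := (DaeLQ.stateMap E Cl).mulVec z
        -- the closed-loop equation is solvable, and the claims hold for its solution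
        (∃ v, DaeLQ.IsClosedLoop Al Bl K t Mz v) ∧
        ∀ v, DaeLQ.IsClosedLoop Al Bl K t Mz v →
          let w : ℝ → Fin n ⊕ Fin m → ℝ := fun s => (Cl - Dl * K (t - s)).mulVec (v s)
          let xs : ℝ → Fin n → ℝ := fun s i => w s (Sum.inl i)
          let us : ℝ → Fin m → ℝ := fun s j => w s (Sum.inr j)
          DaeLQ.IsOptimal E A B Q R Q₀ z t xs us ∧
          DaeLQ.optimalCost E A B Q R Q₀ z t = DaeLQ.cost E Q R Q₀ t xs us ∧
          DaeLQ.cost E Q R Q₀ t xs us = ((Mz ⬝ᵥ (P t).mulVec Mz : ℝ) : EReal) ∧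
          (∀ s ∈ Set.Icc 0 t, us s = (DaeLQ.inputFeedback E Cl Dl K t s).mulVec (xs s)) ∧
          DaeLQ.IsAugmentedSolution E A B Cl Dl K t xs us ∧
          ∀ (x : ℝ → Fin n → ℝ) (u : ℝ → Fin m → ℝ),
            DaeLQ.IsL1loc (Set.Icc 0 t) x → DaeLQ.IsL1loc (Set.Icc 0 t) u →
            DaeLQ.IsAC (Set.Icc 0 t) (fun s => E.mulVec (x s)) → E.mulVec (x 0) = z →
            (DaeLQ.IsAugmentedSolution E A B Cl Dl K t x u ↔
              ∀ᵐ s ∂(MeasureTheory.volume.restrict (Set.Icc 0 t)), x s = xs s ∧ u s = us s) := by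
  have hin := hS.inputNormalized
  refine ⟨?_, fun t ht => ⟨fun P P' hP hP' => hin.riccatiSolution_unique hQ hR hQ₀ hP hP',
    fun P hP z hz => ?_⟩⟩
  · obtain ⟨P, -, hP, -⟩ := hin.exists_riccatiSolution (E := E) (Al := Al) (Cl := Cl) hQ hR hQ₀
    exact ⟨P, hP⟩
  intro K Mz
  refine ⟨hin.exists_closedLoop hQ hR hQ₀ ht hP Mz, fun v hv => ?_⟩
  intro w xs us
  have hK : ContinuousOn K (Set.Icc 0 t) := hin.continuousOn_gain hP.continuousOn
  have hadm : DaeLQ.IsAdmissible E A B z t xs us := hv.admissible hS ht hK hz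
  have hcost : DaeLQ.cost E Q R Q₀ t xs us = ((Mz ⬝ᵥ (P t).mulVec Mz : ℝ) : EReal) :=
    hv.cost_eq hS hQ hR hQ₀ ht hP rfl
  have hopt : DaeLQ.optimalCost E A B Q R Q₀ z t = DaeLQ.cost E Q R Q₀ t xs us := by
    refine le_antisymm (sInf_le ⟨xs, us, hadm, rfl⟩) (le_sInf ?_)
    rintro J ⟨x, u, hxu, rfl⟩
    rw [hcost]
    exact hxu.le_cost hS hQ hR hQ₀ ht hP
  -- Since `𝓜 E xs = v` pointwise, the output is a feedback of `xs` itself; the formula for `us` and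
  -- the augmented constraint are both read off from this.
  have hw : ∀ s, w s = (Cl - Dl * K (t - s)).mulVec ((DaeLQ.stateMap E Cl * E).mulVec (xs s)) :=
    fun s => by
      rw [show (DaeLQ.stateMap E Cl * E).mulVec (xs s) = v s from
        DaeLQ.stateMap_mulVec_output hS _ _]
  have haug : DaeLQ.IsAugmentedSolution E A B Cl Dl K t xs us := by
    refine ⟨hadm.1, Filter.Eventually.of_forall fun s => ?_⟩
    rw [DaeLQ.augmented_constraint_iff, ← hw]
    ext (i | j) <;> rfl
  refine ⟨⟨hadm, hopt.symm, ?_⟩, hopt, hcost, fun s _ => ?_, haug, fun x u _ _ hEx hx0 =>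
    ⟨fun h => ?_, fun h => ⟨hadm.1.congr_ae ht hEx h, ?_⟩⟩⟩
  · rw [hopt, hcost]
    exact EReal.coe_lt_top _
  · ext j
    have := congrFun (hw s) (Sum.inr j)
    rw [Matrix.mulVec_mulVec, ← Matrix.mul_assoc] at this
    exact this
  · filter_upwards [hv.ae_eq hS ht hK hx0 h] with s hs
    exact ⟨funext fun i => congrFun hs (Sum.inl i), funext fun j => congrFun hs (Sum.inr j)⟩
  · filter_upwards [h, haug.2] with s h1 h2
    rw [h1.1, h1.2]
    exact h2
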